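/- **Setting.** A network has $n\ge 1$ classes, a set of output ports (nodes) $v$ and finitely many flows. A flow $f$ has a class, a fixed path (a finite sequence of nodes; the paths may create cyclic dependencies) and a source token bucket: at most $b_f+r_f\tau$ bits in any time interval of length $\tau$. Packets enter the queues as a whole (packetizers), and switching fabrics add no delay. Every class has one FIFO queue at every node $v$, and the $n$ queues of $v$ are served by Deficit Round-Robin (DRR) with quanta $Q_c^v>0$. The node offers to the aggregate of its classes the strict service curve $B^v(t)=R^v[t-T^v]^+$, with $R^v>0$. Packet sizes and quanta are integer multiples of a unit $\epsilon>0$ (packet sizes are positive), a packet of class $c$ at $v$ has size at most $l_c^{v}$, with $l_c^v\ge\epsilon$, and $d_c^{\max,v}:=l_c^v-\epsilon\le Q_c^v$. Write $\beta_{R,T}(x)=R[x-T]^+$ and $\gamma_{r,b}(t)=rt+b$ for $t>0$, $\gamma_{r,b}(0)=0$. **DRR service curves.** For a class $c$ and a set $J$ of other classes let $\gamma_c^{v,J}=\max(\beta_{R_1,T_1},\beta_{R_2,T_2})$ with $$R_1=\frac{Q^v_c}{Q^v_c+\sum_{j\in J}Q^v_j},\quad T_1=\sum_{j\in J}\Big(Q^v_j+d_j^{\max,v}+\frac{Q^v_j}{Q^v_c}d_c^{\max,v}\Big),$$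 $$R_2=\frac{Q^v_c-d_c^{\max,v}}{Q^v_c+\sum_{j\in J}Q^v_j-d_c^{\max,v}}\ (0/0:=0),\quad T_2=\sum_{j\in J}(Q^v_j+d_j^{\max,v}).$$ The degraded-mode curve is $\beta_c^{\mathrm{CDM},v}=\gamma_c^{v,\{j\,:\,j\ne c\}}\circ B^v$. Given input arrival curves $\alpha=(\alpha_c)_c$ at $v$, put $\beta^{(0)}_c=\beta_c^{\mathrm{CDM},v}$ and $$\beta^{(i+1)}_c=\max\Big(\beta^{(i)}_c,\ \max_{J\subseteq\{j\,:\,j\neq c\}}\gamma_c^{v,J}\circ\Big[B^v-\sum_{j\ne c,\ j\notin J}\alpha_j\oslash\beta_j^{(i)}\Big]^+_{\uparrow}\Big),$$ where $(\alpha\oslash\beta)(t)=\sup_{s\ge0}(\alpha(t+s)-\beta(s))$ and $[y]^+_\uparrow$ is the least non-negative non-decreasing function above $y$. Then $\mathrm{DRRservice}_v(\alpha)$ is $\beta^{(m)}$ after a chosen number $m\in\{0,1,2,\dots,\infty\}$ of inner iterations ($m=\infty$ stands for the limit). **TFA.** For a class $c$ with service curves $\beta_c=(\beta_c^v)_v$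 and a burst $z$ in $[0,\infty]$ for every flow of class $c$ at the output of every node of its path, let $\alpha_c^v=\sum\gamma_{r_f,z^{\mathrm{in}}_f}$ (sum over the passages of flows of class $c$ through $v$; $z^{\mathrm{in}}_f$ is $b_f$ at the first node of $f$, and otherwise the burst at the output of the previous node), and let $d_c^v$ be the horizontal deviation of $\alpha_c^v$ and $\beta_c^v$. One round replaces $z$ at the output of $v$ by $z^{\mathrm{in}}_f+r_f d_c^v$ (with $0\cdot\infty=0$). $\mathrm{GenericTFA}_c(\beta_c)=(d_c,z_c)$, where $z_c$ is the limit of the rounds started at $0$, and $d_c$ are the corresponding delays. **Algorithm.** Start from $\beta=\beta^{\mathrm{CDM}}$. In every iteration, for each class $c$ compute $(d_c,z_c)=\mathrm{GenericTFA}_c(\beta_c)$, and then for each node $v$ compute the arrival curves $\alpha^v$ from $z$ and set $\beta^v\leftarrow\mathrm{DRRservice}_v(\alpha^v)$. For given sets $E^{\mathrm{cut}}_c$ of edges of the graphs induced by the flows of class $c$, derive from $z$: the collection $z^{\mathrm{cut}}$ of the bursts of the flows of class $c$ carried by the edges in $E_c^{\mathrm{cut}}$; $b_c^e$, the sum of the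 bursts of the flows of class $c$ carried by the edge $e$; $b_c^v$, the sum of the bursts at the output of $v$ of all the flows of class $c$ that pass $v$. **Theorem.** (1) Whatever numbers of inner iterations are used, at every iteration all the bounds are valid, on every trajectory of the network: $\beta_c^v$ is a finite strict service curve for class $c$ at $v$; $d_c^v$ bounds the delay of every packet of class $c$ at $v$; the components of $z$ and $z^{\mathrm{cut}}$ bound the burstiness of the individual flows, and those of $b$ the burstiness of the aggregates of flows, at the outputs in question (at most burst $+$ rate $\times\,\tau$ bits in any time interval of length $\tau$, counting the bits sent as well as the packets delivered). The components of $d$, $z$, $z^{\mathrm{cut}}$, $b$ may be infinite. (2) If moreover at each node the number of inner iterations is the same in all iterations of the algorithm (or, more generally, never decreases), then, as the number of iterations goes to infinity, $\beta$ converges pointwise to finite limits, and $d$, $z$, $z^{\mathrm{cut}}$, $b$ converge in $[0,\infty]$. -/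

import Mathlib

open scoped NNReal ENNReal Topology

noncomputable section

namespace DRR

/-! ## Curves -/

/-- A curve maps a duration to a (possibly infinite) number of bits. -/
abbrev Curve : Type := ℝ≥0 → ℝ≥0∞

/-- The rate-latency function `x ↦ R [x - T]⁺`; subtraction of extended non-negative reals is
truncated at `0`. -/
def rateLatency (R T : ℝ≥0) (x : ℝ≥0∞) : ℝ≥0∞ := R * (x - T)

/-- The token-bucket curve `γ_{r,b}`, where the burst `b` may be infinite. -/
def tokenBucket (r : ℝ≥0) (b : ℝ≥0∞) : Curve := fun t => if t = 0 then 0 else b + r * t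

/-- Min-plus deconvolution `(α ⊘ β)(t) = sup_{s ≥ 0} (α (t + s) - β s)`. Truncation of the
subtraction is harmless whenever `β 0 = 0`, since the term `s = 0` is then non-negative. -/
def deconv (α β : Curve) : Curve := fun t => ⨆ s : ℝ≥0, (α (t + s) - β s)

/-- Non-decreasing closure `t ↦ sup_{s ≤ t} y s`. Applied to a truncated difference it is the
non-decreasing and non-negative closure `[·]⁺_↑` of the difference. -/
def monoClosure (y : Curve) : Curve := fun t => ⨆ s : Set.Iic t, y s

/-- Horizontal deviation: the largest, over `t`, of the smallest `δ` with `α t ≤ β (t + δ)`. -/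
def hDev (α β : Curve) : ℝ≥0∞ := ⨆ t : ℝ≥0, ⨅ (δ : ℝ≥0) (_ : α t ≤ β (t + δ)), (δ : ℝ≥0∞)

/-! ## One DRR server -/

/-- What is observed at a server with `n` queues: `J` is the set of packets, and each packet has a
class, a size, a time at which it enters its queue (as a whole, after the packetizer), a time at
which its last bit leaves, and the number of its bits that have left by any given time. The value
`⊤` of a time means never. -/
structure ServerTrace (n : ℕ) (J : Type) where
  cls : J → Fin n
  size : J → ℝ≥0
  arr : J → ℝ≥0∞
  dep : J → ℝ≥0∞
  served : J → ℝ≥0 → ℝ≥0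

/-- State of the DRR scheduler: the queue under visit, whether a service of this queue has been
opened, the deficits, and the packets already sent. -/
structure SchedulerState (n : ℕ) (J : Type) where
  ptr : Fin n
  serving : Bool
  deficit : Fin n → ℝ≥0
  sent : Set J

namespace ServerTrace

variable {n : ℕ} {J : Type}

/-- Packet `j` is in queue `c` at time `t` when the packets of `S` have been sent. -/
def Waiting (X : ServerTrace n J) (c : Fin n) (t : ℝ≥0) (S : Set J) (j : J) : Prop :=
  X.cls j = c ∧ X.arr j ≤ t ∧ j ∉ S

/-- Packet `j` is the head of the FIFO queue `c`; `before` is the order of entrance. -/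
def IsHead (X : ServerTrace n J) (before : J → J → Prop) (c : Fin n) (t : ℝ≥0) (S : Set J)
    (j : J) : Prop :=
  X.Waiting c t S j ∧ ∀ i, X.Waiting c t S i → i = j ∨ before j i

/-- One step of the infinite DRR loop, from state `σ` at time `t` to state `σ'` at time `t'`; the
label is the packet that is transmitted in this step, if any.
* `skip`: the visited queue is empty, so go to the next one; time may elapse only as long as all the
  queues are empty.
* `begin_service`: the visited queue is non-empty, so its deficit grows by its quantum.
* `send`: the head packet does not exceed the deficit, so it is transmitted.
* `close_deficit`: the deficit is smaller than the head packet, so the service ends.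
* `close_empty`: the queue is empty, so the service ends and the deficit is reset. -/
inductive Step [NeZero n] (X : ServerTrace n J) (Q : Fin n → ℝ≥0) (before : J → J → Prop) :
    ℝ≥0 → SchedulerState n J → Option J → ℝ≥0 → SchedulerState n J → Prop
  | skip (t t' : ℝ≥0) (c : Fin n) (δ : Fin n → ℝ≥0) (S : Set J)
      (hempty : ∀ j, ¬ X.Waiting c t S j) (ht : t ≤ t')
      (hidle : ∀ u, t ≤ u → u < t' → ∀ c' j, ¬ X.Waiting c' u S j) :
      Step X Q before t ⟨c, false, δ, S⟩ none t' ⟨c + 1, false, δ, S⟩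
  | begin_service (t : ℝ≥0) (c : Fin n) (δ : Fin n → ℝ≥0) (S : Set J)
      (hne : ∃ j, X.Waiting c t S j) :
      Step X Q before t ⟨c, false, δ, S⟩ none
        t ⟨c, true, Function.update δ c (δ c + Q c), S⟩
  | send (t t' : ℝ≥0) (c : Fin n) (δ : Fin n → ℝ≥0) (S : Set J) (j : J)
      (hj : X.IsHead before c t S j) (hsize : X.size j ≤ δ c) (ht : t < t') :
      Step X Q before t ⟨c, true, δ, S⟩ (some j)
        t' ⟨c, true, Function.update δ c (δ c - X.size j), insert j S⟩
  | close_deficit (t : ℝ≥0) (c : Fin n) (δ : Fin n → ℝ≥0) (S : Set J) (j : J)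
      (hj : X.IsHead before c t S j) (hsize : δ c < X.size j) :
      Step X Q before t ⟨c, true, δ, S⟩ none t ⟨c + 1, false, δ, S⟩
  | close_empty (t : ℝ≥0) (c : Fin n) (δ : Fin n → ℝ≥0) (S : Set J)
      (hempty : ∀ j, ¬ X.Waiting c t S j) :
      Step X Q before t ⟨c, true, δ, S⟩ none t ⟨c + 1, false, Function.update δ c 0, S⟩

/-- The bits of packet `j` leave during `[t, t']`, at an arbitrary pace, the last one at `t'`. -/
def TransmittedDuring (X : ServerTrace n J) (j : J) (t t' : ℝ≥0) : Prop :=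
  X.dep j = t' ∧ Monotone (X.served j) ∧ (∀ u ≤ t, X.served j u = 0) ∧
    (∀ u < t', X.served j u < X.size j) ∧ ∀ u, t' ≤ u → X.served j u = X.size j

/-- The trace results from DRR scheduling with quanta `Q`, FIFO inside every queue: there are an
order of entrance that agrees with the arrival times, and a run of the DRR loop from the empty
state (`time i`, `state i` before the `i`-th step) that transmits the packets as in the trace. -/
def IsDRR [NeZero n] (X : ServerTrace n J) (Q : Fin n → ℝ≥0) : Prop :=
  ∃ (before : J → J → Prop) (time : ℕ → ℝ≥0) (state : ℕ → SchedulerState n J)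
    (tx : ℕ → Option J),
    IsStrictTotalOrder J before ∧
    (∀ i j, X.arr i < X.arr j → before i j) ∧
    time 0 = 0 ∧ (∃ c, state 0 = ⟨c, false, fun _ => 0, ∅⟩) ∧
    (∀ i, X.Step Q before (time i) (state i) (tx i) (time (i + 1)) (state (i + 1))) ∧
    Filter.Tendsto time Filter.atTop Filter.atTop ∧
    (∀ i j, tx i = some j → X.TransmittedDuring j (time i) (time (i + 1))) ∧
    (∀ j, (∀ i, tx i ≠ some j) → X.dep j = ⊤ ∧ ∀ u, X.served j u = 0)

/-- Some packet of `S` is in the server at time `u`. -/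
def Backlogged (X : ServerTrace n J) (S : Set J) (u : ℝ≥0) : Prop :=
  ∃ j ∈ S, X.arr j ≤ u ∧ u < X.dep j

/-- `β` is a strict service curve for the packets of `S`: at least `β (t - s)` bits of `S` are
served in any period `(s, t]` during which `S` is backlogged. -/
def StrictService (X : ServerTrace n J) (S : Set J) (β : Curve) : Prop :=
  ∀ s t : ℝ≥0, s ≤ t → (∀ u, s ≤ u → u < t → X.Backlogged S u) →
    β (t - s) ≤ ∑' j : S, ((X.served j t : ℝ≥0∞) - X.served j s)

end ServerTrace

/-! ## Networks -/

/-- A network with `n` classes, set of non-terminal output ports `V` and set of flows `F`. Flow `f`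
visits the ports `node f 0, …, node f (hops f - 1)` in this order. -/
structure Network (n : ℕ) (V F : Type) where
  /-- class of a flow -/
  cls : F → Fin n
  /-- number of output ports on the path of a flow -/
  hops : F → ℕ
  /-- path of a flow -/
  node : (f : F) → Fin (hops f) → V
  /-- rate of the source token bucket of a flow -/
  rate : F → ℝ≥0
  /-- burst of the source token bucket of a flow -/
  burst : F → ℝ≥0
  /-- smallest unit of information seen by the schedulers -/
  eps : ℝ≥0
  /-- DRR quantum of a class at a port -/
  quantum : V → Fin n → ℝ≥0
  /-- upper bound on the packet size of a class at a port -/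
  lmax : V → Fin n → ℝ≥0
  /-- rate of the aggregate strict service curve of a port -/
  svcRate : V → ℝ≥0
  /-- latency of the aggregate strict service curve of a port -/
  svcLatency : V → ℝ≥0
  eps_pos : 0 < eps
  quantum_pos : ∀ v c, 0 < quantum v c
  quantum_unit : ∀ v c, ∃ m : ℕ, quantum v c = m * eps
  eps_le_lmax : ∀ v c, eps ≤ lmax v c
  /-- the maximum residual deficit does not exceed the quantum -/
  residual_le : ∀ v c, lmax v c - eps ≤ quantum v c
  svcRate_pos : ∀ v, 0 < svcRate v

namespace Network

variable {n : ℕ} {V F : Type}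

/-- Flows of class `c`. -/
abbrev FlowOf (N : Network n V F) (c : Fin n) : Type := {f : F // N.cls f = c}

/-- Pairs of a flow of class `c` and (the index of) a port on its path. A hop also stands for the
output of that port. -/
abbrev Hop (N : Network n V F) (c : Fin n) : Type := (f : N.FlowOf c) × Fin (N.hops f)

/-- The port of a hop. -/
def port (N : Network n V F) {c : Fin n} (h : N.Hop c) : V := N.node h.1 h.2

/-- After hop `h` the flow is carried by the edge `e`: the port of `h` is `e.1`, and the next port on
the path is `e.2`. -/
def Carried (N : Network n V F) {c : Fin n} (h : N.Hop c) (e : V × V) : Prop :=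
  N.port h = e.1 ∧ ∃ hk : (h.2 : ℕ) + 1 < N.hops h.1, N.node h.1 ⟨h.2 + 1, hk⟩ = e.2

/-- Edges of the graph induced by the flows of class `c`. -/
def edges (N : Network n V F) (c : Fin n) : Set (V × V) := {e | ∃ h : N.Hop c, N.Carried h e}

/-- Aggregate strict service curve `B^v` of a port. -/
def aggService (N : Network n V F) (v : V) : Curve :=
  fun t => rateLatency (N.svcRate v) (N.svcLatency v) t

/-- Maximum residual deficit. -/
def dmax (N : Network n V F) (v : V) (c : Fin n) : ℝ≥0 := N.lmax v c - N.eps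

/-! ### Packets and trajectories -/

/-- The packets of the network, with their flow, their size, the times `arr p k` at which they enter
the queue of their `k`-th port (as whole packets) and the number `served p k t` of their bits that
the `k`-th port has sent by time `t`. Since packetizers and switching fabrics add no delay,
`arr p (k + 1)` is also the time at which the last bit of `p` leaves the `k`-th port. -/
structure Packets (N : Network n V F) where
  P : Type
  flow : P → F
  size : P → ℝ≥0
  arr : P → ℕ → ℝ≥0∞
  served : P → ℕ → ℝ≥0 → ℝ≥0

namespace Packets

variable {N : Network n V F}

/-- Passages of packets through port `v`. -/
abbrev Job (X : N.Packets) (v : V) : Type :=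
  {j : (p : X.P) × Fin (N.hops (X.flow p)) // N.node (X.flow j.1) j.2 = v}

/-- What is observed at port `v`. -/
def trace (X : N.Packets) (v : V) : ServerTrace n (X.Job v) where
  cls j := N.cls (X.flow j.1.1)
  size j := X.size j.1.1
  arr j := X.arr j.1.1 j.1.2
  dep j := X.arr j.1.1 (j.1.2 + 1)
  served j := X.served j.1.1 j.1.2

/-- Number of bits of packets of flow `f` with `arr p k` in the closed interval `[s, t]`. -/
def arrBits (X : N.Packets) (f : F) (k : ℕ) (s t : ℝ≥0) : ℝ≥0∞ :=
  ∑' p : {p : X.P // X.flow p = f ∧ (s : ℝ≥0∞) ≤ X.arr p k ∧ X.arr p k ≤ t}, (X.size p : ℝ≥0∞)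

/-- Number of bits of flow `f` that its `k`-th port sends in `(s, t]`. -/
def outBits (X : N.Packets) (f : F) (k : ℕ) (s t : ℝ≥0) : ℝ≥0∞ :=
  ∑' p : {p : X.P // X.flow p = f}, ((X.served p k t : ℝ≥0∞) - X.served p k s)

/-- The packets form a possible trajectory of the network. -/
structure IsTrajectory [NeZero n] (X : N.Packets) : Prop where
  /-- sizes are positive multiples of the unit of information -/
  size_unit : ∀ p, ∃ m : ℕ, 0 < m ∧ X.size p = m * N.eps
  size_le : ∀ p k, X.size p ≤ N.lmax (N.node (X.flow p) k) (N.cls (X.flow p))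
  /-- token-bucket constraint of every flow at its source -/
  source : ∀ f s t, s ≤ t →
    X.arrBits f 0 s t ≤ (N.burst f : ℝ≥0∞) + N.rate f * ((t - s : ℝ≥0) : ℝ≥0∞)
  /-- every port uses DRR -/
  drr : ∀ v, (X.trace v).IsDRR (N.quantum v)
  /-- every port offers its aggregate strict service curve -/
  service : ∀ v, (X.trace v).StrictService Set.univ (N.aggService v)

/-- `b` bounds the burstiness of the aggregate of the flows at the outputs `H`, both for the bits
that leave the ports and for the packets that are delivered (after the packetizers) downstream. -/
def IsBurstBound (X : N.Packets) {c : Fin n} (H : Finset (N.Hop c)) (b : ℝ≥0∞) : Prop :=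
  ∀ s t : ℝ≥0, s ≤ t →
    ∑ h ∈ H, X.outBits h.1 h.2 s t
        ≤ b + (∑ h ∈ H, (N.rate h.1 : ℝ≥0∞)) * ((t - s : ℝ≥0) : ℝ≥0∞) ∧
      ∑ h ∈ H, X.arrBits h.1 (h.2 + 1) s t
        ≤ b + (∑ h ∈ H, (N.rate h.1 : ℝ≥0∞)) * ((t - s : ℝ≥0) : ℝ≥0∞)

end Packets

/-! ### Strict service curves of DRR -/

/-- The function `γ_c^{convex,v,J}`, for a set `J` of classes other than `c`. -/
def gammaConvex (N : Network n V F) (v : V) (c : Fin n) (J : Finset (Fin n)) (x : ℝ≥0∞) : ℝ≥0∞ :=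
  max
    (rateLatency
      (N.quantum v c / (N.quantum v c + ∑ c' ∈ J, N.quantum v c'))
      (∑ c' ∈ J, (N.quantum v c' + N.dmax v c' + N.quantum v c' / N.quantum v c * N.dmax v c)) x)
    (rateLatency
      ((N.quantum v c - N.dmax v c) / (N.quantum v c + ∑ c' ∈ J, N.quantum v c' - N.dmax v c))
      (∑ c' ∈ J, (N.quantum v c' + N.dmax v c')) x)

/-- Strict service curve in degraded operational mode, `β_c^{CDM,v}`. -/
def cdm (N : Network n V F) (v : V) (c : Fin n) : Curve :=
  fun t => N.gammaConvex v c (Finset.univ.erase c) (N.aggService v t)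

/-- The mapping `Π_v^{convex}`: improves the strict service curves `β` at `v` with the help of the
output arrival curves `αout`. -/
def improve (N : Network n V F) (v : V) (αout β : Fin n → Curve) : Fin n → Curve := fun c t =>
  max (β c t)
    ((Finset.univ.erase c).powerset.sup fun J =>
      N.gammaConvex v c J
        (monoClosure (fun s => N.aggService v s - ∑ c' ∈ Finset.univ.erase c \ J, αout c' s) t))

/-- `m` iterations of the improvement, given the input arrival curves `α`. -/
def improveIter (N : Network n V F) (v : V) (α : Fin n → Curve) : ℕ → Fin n → Curve
  | 0 => N.cdm v
  | m + 1 => N.improve v (fun c => deconv (α c) (improveIter N v α m c)) (improveIter N v α m)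

/-- `DRRservice_v^{inputArrival}(α)`, with `m` iterations; `m = ⊤` stands for the limit. -/
def drrService (N : Network n V F) (v : V) (m : ℕ∞) (α : Fin n → Curve) : Fin n → Curve :=
  fun c t => if m = ⊤ then ⨆ i : ℕ, N.improveIter v α i c t else N.improveIter v α m.toNat c t

/-! ### Total flow analysis -/

section TFA

variable [Fintype F]

open Classical in
/-- Hops of class `c` at port `v`. -/
def hopsAt (N : Network n V F) (c : Fin n) (v : V) : Finset (N.Hop c) :=
  Finset.univ.filter fun h => N.port h = v

open Classical in
/-- Hops of class `c` whose output is carried by the edge `e`. -/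
def hopsOn (N : Network n V F) (c : Fin n) (e : V × V) : Finset (N.Hop c) :=
  Finset.univ.filter fun h => N.Carried h e

/-- Burst of the flow at the input of hop `h`: the source burst at the first port, otherwise the
propagated burst at the output of the previous port. -/
def inBurst (N : Network n V F) {c : Fin n} (z : N.Hop c → ℝ≥0∞) (h : N.Hop c) : ℝ≥0∞ :=
  if (h.2 : ℕ) = 0 then (N.burst h.1 : ℝ≥0∞)
  else z ⟨h.1, ⟨h.2 - 1, lt_of_le_of_lt (Nat.sub_le _ _) h.2.isLt⟩⟩

/-- Input arrival curve of class `c` at port `v`, from the propagated bursts `z`. -/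
def arrivalCurve (N : Network n V F) (c : Fin n) (z : N.Hop c → ℝ≥0∞) (v : V) : Curve :=
  fun t => ∑ h ∈ N.hopsAt c v, tokenBucket (N.rate h.1) (N.inBurst z h) t

/-- Delay bound of class `c` at port `v`, from the propagated bursts `z` and the service curves. -/
def tfaDelay (N : Network n V F) (c : Fin n) (β : V → Curve) (z : N.Hop c → ℝ≥0∞) (v : V) :
    ℝ≥0∞ :=
  hDev (N.arrivalCurve c z v) (β v)

/-- One synchronous round of TFA for class `c`. -/
def tfaStep (N : Network n V F) (c : Fin n) (β : V → Curve) (z : N.Hop c → ℝ≥0∞) :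
    N.Hop c → ℝ≥0∞ :=
  fun h => N.inBurst z h + N.rate h.1 * N.tfaDelay c β z (N.port h)

/-- `GenericTFA_c(β)`: limit, from zero, of the rounds of TFA (a non-decreasing sequence), with the
resulting per-node delay bounds in the first component, and the propagated bursts in the second. -/
def genericTFA (N : Network n V F) (c : Fin n) (β : V → Curve) :
    (V → ℝ≥0∞) × (N.Hop c → ℝ≥0∞) :=
  let z : N.Hop c → ℝ≥0∞ := fun h => ⨆ i : ℕ, (N.tfaStep c β)^[i] (fun _ => 0) h
  (N.tfaDelay c β z, z)

/-! ### The algorithm -/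

/-- The collections of bounds handled by the algorithm. -/
structure Bounds (N : Network n V F) (Ecut : Fin n → Set (V × V)) where
  /-- strict service curves -/
  β : Fin n → V → Curve
  /-- per-node delays -/
  d : Fin n → V → ℝ≥0∞
  /-- propagated bursts, of all flows at all outputs -/
  z : (c : Fin n) → N.Hop c → ℝ≥0∞
  /-- bursts of the flows at the cuts -/
  zcut : (c : Fin n) → {h : N.Hop c // ∃ e ∈ Ecut c, N.Carried h e} → ℝ≥0∞
  /-- aggregate bursts on the edges -/
  bEdge : (c : Fin n) → N.edges c → ℝ≥0∞
  /-- aggregate bursts at the outputs of the nodes -/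
  bNode : Fin n → V → ℝ≥0∞

/-- Service curves before iteration `k` of the main loop (numbered from `0`), where the
service-curve update of iteration `k` at node `v` performs `m k v` inner iterations. -/
def serviceIter (N : Network n V F) (m : ℕ → V → ℕ∞) : ℕ → Fin n → V → Curve
  | 0 => fun c v => N.cdm v c
  | k + 1 => fun c v =>
      N.drrService v (m k v)
        (fun c' => N.arrivalCurve c' (N.genericTFA c' (serviceIter N m k c')).2 v) c

/-- All the bounds at iteration `k`. -/
def algorithm (N : Network n V F) (m : ℕ → V → ℕ∞) (Ecut : Fin n → Set (V × V)) (k : ℕ) :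
    N.Bounds Ecut where
  β := N.serviceIter m k
  d c := (N.genericTFA c (N.serviceIter m k c)).1
  z c := (N.genericTFA c (N.serviceIter m k c)).2
  zcut c h := (N.genericTFA c (N.serviceIter m k c)).2 h
  bEdge c e := ∑ h ∈ N.hopsOn c e, (N.genericTFA c (N.serviceIter m k c)).2 h
  bNode c v := ∑ h ∈ N.hopsAt c v, (N.genericTFA c (N.serviceIter m k c)).2 h

/-- The bounds hold on every trajectory of the network, and the service curves are finite. -/
structure Bounds.Valid [NeZero n] {N : Network n V F} {Ecut : Fin n → Set (V × V)}
    (x : N.Bounds Ecut) : Prop where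
  finite : ∀ c v t, x.β c v t ≠ ⊤
  service : ∀ X : N.Packets, X.IsTrajectory → ∀ c v,
    (X.trace v).StrictService {j | (X.trace v).cls j = c} (x.β c v)
  delay : ∀ X : N.Packets, X.IsTrajectory → ∀ c v, ∀ j : X.Job v, (X.trace v).cls j = c →
    (X.trace v).dep j ≤ (X.trace v).arr j + x.d c v
  burst : ∀ X : N.Packets, X.IsTrajectory → ∀ c h, X.IsBurstBound {h} (x.z c h)
  cut : ∀ X : N.Packets, X.IsTrajectory → ∀ c h, X.IsBurstBound {h.1} (x.zcut c h)
  edge : ∀ X : N.Packets, X.IsTrajectory → ∀ c, ∀ e : N.edges c,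
    X.IsBurstBound (N.hopsOn c e) (x.bEdge c e)
  node : ∀ X : N.Packets, X.IsTrajectory → ∀ c v,
    X.IsBurstBound (N.hopsAt c v) (x.bNode c v)

/-- Convergence of a sequence of bounds: pointwise, with a finite limit, for the service curves, and
in `[0, ∞]` for the other components. -/
def Bounds.Converges {N : Network n V F} {Ecut : Fin n → Set (V × V)}
    (x : ℕ → N.Bounds Ecut) : Prop :=
  ∃ y : N.Bounds Ecut,
    (∀ c v t, y.β c v t ≠ ⊤ ∧
      Filter.Tendsto (fun k => (x k).β c v t) Filter.atTop (𝓝 (y.β c v t))) ∧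
    (∀ c v, Filter.Tendsto (fun k => (x k).d c v) Filter.atTop (𝓝 (y.d c v))) ∧
    (∀ c h, Filter.Tendsto (fun k => (x k).z c h) Filter.atTop (𝓝 (y.z c h))) ∧
    (∀ c h, Filter.Tendsto (fun k => (x k).zcut c h) Filter.atTop (𝓝 (y.zcut c h))) ∧
    (∀ c e, Filter.Tendsto (fun k => (x k).bEdge c e) Filter.atTop (𝓝 (y.bEdge c e))) ∧
    (∀ c v, Filter.Tendsto (fun k => (x k).bNode c v) Filter.atTop (𝓝 (y.bNode c v)))

end TFA

end Network

end DRR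

end

/-! The bounds are valid and converge for the following reasons.

*Convergence.* Every operation of the algorithm is monotone: larger service curves give smaller
delays and bursts (`genericTFA_fst_mono`, `genericTFA_snd_mono`), and smaller arrival curves and more
inner iterations give larger service curves (`drrService_mono`). The first iteration improves the
degraded-mode curves, so by induction the service curves increase and all the other bounds decrease.
The service curves stay below the aggregate curve (`serviceIter_le`), hence their limits are finite.

*Service curves.* During a period in which class `c` is backlogged, the scheduler neither skips `c`
nor resets its deficit, so between two services of `c` any other class is served at most once. As
residual deficits are bounded (`Step.deficitBound`), there is a number `p` of rounds such that `c`
gets at least `p` quanta up to a residual deficit, and any other class at most `p + 1` quanta and a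
residual deficit (`IsRun.exists_rounds`, by the invariant `RoundBalance`). Together with the aggregate
service curve this gives the curves `γ_c^J` (`gammaConvex_le_of_rounds`), where the classes outside
`J` are bounded by their output arrival curves (`IsFIFO.servedBits_le_deconv`).

*Total flow analysis.* The limit of the rounds from zero is a fixed point even when some components
are infinite, since horizontal deviations from non-decreasing service curves are left-continuous in
the arrival curve (`hDev_iSup_le`, `tfaStep_genericTFA_le`). To see that it is valid in spite of cyclic
dependencies, consider the earliest arrival time of a packet that violates its delay bound; it exists
because only finitely many packets arrive in a finite time. Transmissions take time, so every packet
that has reached its present port by then arrived at its previous ports strictly earlier, and met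
the delay bounds there. Hence the bursts up to that time are as computed, and they bound the delay of
the packet, a contradiction (`IsTrajectory.arr_succ_le_add_delay`).

Validity at every iteration follows by induction, each of the two analyses using the bounds of the
other one (`IsTrajectory.strictService_serviceIter`, `algorithm_valid`). -/

noncomputable section

namespace DRR

/-! ### Monotonicity of the curve operations -/

theorem rateLatency_mono (R T : ℝ≥0) : Monotone (rateLatency R T) := fun _ _ h =>
  mul_le_mul_right (tsub_le_tsub_right h _) _

theorem rateLatency_le_self {R : ℝ≥0} (hR : R ≤ 1) (T : ℝ≥0) (x : ℝ≥0∞) :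
    rateLatency R T x ≤ x := by
  have h1 : (R : ℝ≥0∞) ≤ 1 := by exact_mod_cast hR
  calc rateLatency R T x ≤ 1 * x := mul_le_mul' h1 tsub_le_self
    _ = x := one_mul x

theorem rateLatency_iSup {ι : Sort*} (R T : ℝ≥0) (x : ι → ℝ≥0∞) :
    rateLatency R T (⨆ i, x i) = ⨆ i, rateLatency R T (x i) := by
  simp only [rateLatency, ENNReal.iSup_sub, ENNReal.mul_iSup]

theorem tokenBucket_mono (r : ℝ≥0) {b b' : ℝ≥0∞} (h : b ≤ b') (t : ℝ≥0) :
    tokenBucket r b t ≤ tokenBucket r b' t := by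
  unfold tokenBucket
  split_ifs
  · exact le_rfl
  · gcongr

theorem deconv_mono {α α' β β' : Curve} (hα : α ≤ α') (hβ : β' ≤ β) :
    deconv α β ≤ deconv α' β' := fun _ =>
  iSup_mono fun s => tsub_le_tsub (hα _) (hβ s)

theorem monoClosure_monotone (y : Curve) : Monotone (monoClosure y) := fun _ t h =>
  iSup_le fun u => le_iSup (fun u : Set.Iic t => y u) ⟨u, u.2.trans h⟩

theorem monoClosure_mono {y y' : Curve} (h : y ≤ y') : monoClosure y ≤ monoClosure y' :=
  fun _ => iSup_mono fun s => h s

theorem monoClosure_le {y g : Curve} (hg : Monotone g) (h : y ≤ g) : monoClosure y ≤ g :=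
  fun _ => iSup_le fun s => (h s).trans (hg s.2)

theorem hDev_mono {α α' β β' : Curve} (hα : α ≤ α') (hβ : β' ≤ β) : hDev α β ≤ hDev α' β' :=
  iSup_mono fun t => le_iInf₂ fun δ h => iInf₂_le δ ((hα t).trans (h.trans (hβ _)))

/-- The horizontal deviation from a non-decreasing service curve is continuous along non-decreasing
sequences of arrival curves, since the pseudo-inverse of a non-decreasing function is
left-continuous. -/
theorem hDev_iSup_le {β : Curve} (hβ : Monotone β) (α : ℕ → Curve) :
    hDev (fun t => ⨆ i, α i t) β ≤ ⨆ i, hDev (α i) β := by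
  refine iSup_le fun t => le_of_forall_gt fun D hD => ?_
  obtain ⟨D', hD1, hD2⟩ := ENNReal.lt_iff_exists_nnreal_btwn.1 hD
  refine lt_of_le_of_lt (iInf₂_le (f := fun (δ : ℝ≥0) (_ : (⨆ i, α i t) ≤ β (t + δ)) =>
    (δ : ℝ≥0∞)) D' (iSup_le fun i => ?_)) hD2
  have h1 : (⨅ (δ : ℝ≥0) (_ : α i t ≤ β (t + δ)), (δ : ℝ≥0∞)) < (D' : ℝ≥0∞) :=
    lt_of_le_of_lt (le_iSup_of_le (f := fun i => hDev (α i) β) i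
      (le_iSup (α := ℝ≥0∞) (fun t : ℝ≥0 =>
        ⨅ (δ : ℝ≥0) (_ : α i t ≤ β (t + δ)), (δ : ℝ≥0∞)) t)) hD1
  simp only [iInf_lt_iff] at h1
  obtain ⟨δ, hδ, hlt⟩ := h1
  exact hδ.trans (hβ (by gcongr; exact_mod_cast hlt.le))

namespace Network

variable {n : ℕ} {V F : Type} (N : Network n V F)

theorem gammaConvex_mono (v : V) (c : Fin n) (J : Finset (Fin n)) :
    Monotone (N.gammaConvex v c J) := fun _ _ h =>
  max_le_max (rateLatency_mono _ _ h) (rateLatency_mono _ _ h)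

theorem gammaConvex_le_self (v : V) (c : Fin n) (J : Finset (Fin n)) (x : ℝ≥0∞) :
    N.gammaConvex v c J x ≤ x := by
  refine max_le (rateLatency_le_self ?_ _ _) (rateLatency_le_self ?_ _ _)
  · exact div_le_one_of_le₀ (le_add_of_nonneg_right zero_le) zero_le
  · refine div_le_one_of_le₀ (tsub_le_tsub_right ?_ _) zero_le
    exact le_add_of_nonneg_right zero_le

theorem gammaConvex_iSup_le {ι : Sort*} {v : V} {c : Fin n} {J : Finset (Fin n)} {x : ι → ℝ≥0∞}
    {b : ℝ≥0∞} (h : ∀ i, N.gammaConvex v c J (x i) ≤ b) :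
    N.gammaConvex v c J (⨆ i, x i) ≤ b := by
  unfold gammaConvex at h ⊢
  rw [rateLatency_iSup, rateLatency_iSup]
  exact max_le (iSup_le fun i => (le_max_left _ _).trans (h i))
    (iSup_le fun i => (le_max_right _ _).trans (h i))

theorem aggService_monotone (v : V) : Monotone (N.aggService v) := fun _ _ h =>
  rateLatency_mono _ _ (by exact_mod_cast h)

theorem aggService_ne_top (v : V) (t : ℝ≥0) : N.aggService v t ≠ ⊤ := by
  unfold aggService rateLatency
  exact ENNReal.mul_ne_top ENNReal.coe_ne_top (ENNReal.sub_ne_top ENNReal.coe_ne_top)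

/-! ### Monotonicity of the service-curve improvements -/

theorem improve_le (v : V) (αout : Fin n → Curve) {β : Fin n → Curve}
    (hβ : ∀ c, β c ≤ N.aggService v) (c : Fin n) : N.improve v αout β c ≤ N.aggService v :=
  fun t => max_le (hβ c t) <| Finset.sup_le fun _ _ =>
    (N.gammaConvex_le_self _ _ _ _).trans
      (monoClosure_le (N.aggService_monotone v) (fun _ => tsub_le_self) t)

theorem improve_monotone (v : V) (αout : Fin n → Curve) {β : Fin n → Curve}
    (hβ : ∀ c, Monotone (β c)) (c : Fin n) : Monotone (N.improve v αout β c) := fun _ _ h =>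
  max_le_max (hβ c h) <| Finset.sup_mono_fun fun _ _ =>
    N.gammaConvex_mono _ _ _ (monoClosure_monotone _ h)

theorem improve_mono (v : V) {α α' β β' : Fin n → Curve} (hα : α' ≤ α) (hβ : β ≤ β') :
    N.improve v α β ≤ N.improve v α' β' := fun c t =>
  max_le_max (hβ c t) <| Finset.sup_mono_fun fun _ _ =>
    N.gammaConvex_mono _ _ _ (monoClosure_mono (fun s =>
      tsub_le_tsub_left (Finset.sum_le_sum fun c' _ => hα c' s) _) t)

theorem cdm_le (v : V) (c : Fin n) : N.cdm v c ≤ N.aggService v := fun _ =>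
  N.gammaConvex_le_self _ _ _ _

theorem cdm_monotone (v : V) (c : Fin n) : Monotone (N.cdm v c) := fun _ _ h =>
  N.gammaConvex_mono _ _ _ (N.aggService_monotone v h)

theorem improveIter_le (v : V) (α : Fin n → Curve) (i : ℕ) (c : Fin n) :
    N.improveIter v α i c ≤ N.aggService v := by
  induction i generalizing c with
  | zero => exact N.cdm_le v c
  | succ i ih => exact N.improve_le v _ ih c

theorem improveIter_monotone (v : V) (α : Fin n → Curve) (i : ℕ) (c : Fin n) :
    Monotone (N.improveIter v α i c) := by
  induction i generalizing c with
  | zero => exact N.cdm_monotone v c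
  | succ i ih => exact N.improve_monotone v _ ih c

theorem improveIter_mono_index (v : V) (α : Fin n → Curve) : Monotone (N.improveIter v α) :=
  monotone_nat_of_le_succ fun _ _ _ => le_max_left _ _

theorem improveIter_antitone (v : V) {α α' : Fin n → Curve} (hα : α' ≤ α) (i : ℕ) :
    N.improveIter v α i ≤ N.improveIter v α' i := by
  induction i with
  | zero => exact le_rfl
  | succ i ih => exact N.improve_mono v (fun c => deconv_mono (hα c) (ih c)) ih

theorem drrService_le (v : V) (m : ℕ∞) (α : Fin n → Curve) (c : Fin n) :
    N.drrService v m α c ≤ N.aggService v := by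
  intro t
  unfold drrService
  split_ifs
  · exact iSup_le fun i => N.improveIter_le v α i c t
  · exact N.improveIter_le v α _ c t

theorem drrService_monotone (v : V) (m : ℕ∞) (α : Fin n → Curve) (c : Fin n) :
    Monotone (N.drrService v m α c) := by
  intro s t h
  unfold drrService
  split_ifs
  · exact iSup_mono fun i => N.improveIter_monotone v α i c h
  · exact N.improveIter_monotone v α _ c h

theorem cdm_le_drrService (v : V) (m : ℕ∞) (α : Fin n → Curve) :
    N.cdm v ≤ N.drrService v m α := by
  intro c t
  unfold drrService
  split_ifs
  · exact le_iSup (fun i => N.improveIter v α i c t) 0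
  · exact N.improveIter_mono_index v α (Nat.zero_le _) c t

theorem drrService_mono (v : V) {m m' : ℕ∞} (hm : m ≤ m') {α α' : Fin n → Curve} (hα : α' ≤ α) :
    N.drrService v m α ≤ N.drrService v m' α' := by
  intro c t
  unfold drrService
  split_ifs with h h' h'
  · exact iSup_mono fun i => N.improveIter_antitone v hα i c t
  · exact absurd (top_le_iff.1 (h ▸ hm)) h'
  · exact le_iSup_of_le _ (N.improveIter_antitone v hα _ c t)
  · exact (N.improveIter_antitone v hα _ c t).trans
      (N.improveIter_mono_index v α' (ENat.toNat_le_toNat hm h') c t)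

/-! ### Total flow analysis is monotone, and its limit is a fixed point -/

theorem inBurst_mono {c : Fin n} {z z' : N.Hop c → ℝ≥0∞} (h : z ≤ z') :
    N.inBurst z ≤ N.inBurst z' := by
  intro k
  unfold inBurst
  split_ifs
  · exact le_rfl
  · exact h _

theorem inBurst_iSup {c : Fin n} (z : ℕ → N.Hop c → ℝ≥0∞) (h : N.Hop c) :
    N.inBurst (fun h => ⨆ i, z i h) h = ⨆ i, N.inBurst (z i) h := by
  unfold inBurst
  split_ifs
  · exact (ciSup_const).symm
  · rfl

variable [Fintype F]

theorem arrivalCurve_mono (c : Fin n) {z z' : N.Hop c → ℝ≥0∞} (h : z ≤ z') (v : V) :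
    N.arrivalCurve c z v ≤ N.arrivalCurve c z' v := fun t =>
  Finset.sum_le_sum fun k _ => tokenBucket_mono _ (N.inBurst_mono h k) t

theorem arrivalCurve_iSup (c : Fin n) {z : ℕ → N.Hop c → ℝ≥0∞} (hz : Monotone z) (v : V) :
    N.arrivalCurve c (fun h => ⨆ i, z i h) v = fun t => ⨆ i, N.arrivalCurve c (z i) v t := by
  funext t
  unfold arrivalCurve
  rw [← ENNReal.finsetSum_iSup_of_monotone]
  · refine Finset.sum_congr rfl fun h _ => ?_
    rw [inBurst_iSup]
    unfold tokenBucket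
    split_ifs
    · simp
    · rw [ENNReal.iSup_add]
  · exact fun h i j hij => tokenBucket_mono _ (N.inBurst_mono (hz hij) h) t

theorem tfaDelay_mono (c : Fin n) {β β' : V → Curve} (hβ : β' ≤ β) {z z' : N.Hop c → ℝ≥0∞}
    (h : z ≤ z') : N.tfaDelay c β z ≤ N.tfaDelay c β' z' := fun v =>
  hDev_mono (N.arrivalCurve_mono c h v) (hβ v)

theorem tfaStep_mono (c : Fin n) {β β' : V → Curve} (hβ : β' ≤ β) {z z' : N.Hop c → ℝ≥0∞}
    (h : z ≤ z') : N.tfaStep c β z ≤ N.tfaStep c β' z' := fun k =>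
  add_le_add (N.inBurst_mono h k) (mul_le_mul_right (N.tfaDelay_mono c hβ h _) _)

theorem tfaStep_iterate_mono (c : Fin n) {β β' : V → Curve} (hβ : β' ≤ β) (i : ℕ) :
    (N.tfaStep c β)^[i] (fun _ => 0) ≤ (N.tfaStep c β')^[i] (fun _ => 0) := by
  induction i with
  | zero => exact le_rfl
  | succ i ih =>
    rw [Function.iterate_succ_apply', Function.iterate_succ_apply']
    exact N.tfaStep_mono c hβ ih

theorem tfaStep_iterate_monotone (c : Fin n) (β : V → Curve) :
    Monotone fun i => (N.tfaStep c β)^[i] (fun _ => 0) := by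
  have hmono : Monotone (N.tfaStep c β) := fun _ _ h => N.tfaStep_mono c le_rfl h
  exact hmono.monotone_iterate_of_le_map (fun _ => zero_le)

theorem genericTFA_snd_mono (c : Fin n) {β β' : V → Curve} (hβ : β' ≤ β) :
    (N.genericTFA c β).2 ≤ (N.genericTFA c β').2 := fun h =>
  iSup_mono fun i => N.tfaStep_iterate_mono c hβ i h

theorem genericTFA_fst_mono (c : Fin n) {β β' : V → Curve} (hβ : β' ≤ β) :
    (N.genericTFA c β).1 ≤ (N.genericTFA c β').1 :=
  N.tfaDelay_mono c hβ (N.genericTFA_snd_mono c hβ)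

/-- The bursts computed by total flow analysis are stable under one more round, even if some of them
are infinite. This is where monotonicity of the service curves is needed. -/
theorem tfaStep_genericTFA_le (c : Fin n) {β : V → Curve} (hβ : ∀ v, Monotone (β v)) :
    N.tfaStep c β (N.genericTFA c β).2 ≤ (N.genericTFA c β).2 := by
  intro h
  have hmono := N.tfaStep_iterate_monotone c β
  set z : ℕ → N.Hop c → ℝ≥0∞ := fun i => (N.tfaStep c β)^[i] (fun _ => 0) with hz
  have hz' : (N.genericTFA c β).2 = fun h => ⨆ i, z i h := rfl
  have hd : N.tfaDelay c β (fun h => ⨆ i, z i h) (N.port h)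
      ≤ ⨆ i, N.tfaDelay c β (z i) (N.port h) := by
    unfold tfaDelay
    rw [N.arrivalCurve_iSup c hmono]
    exact hDev_iSup_le (hβ _) _
  rw [hz']
  calc N.tfaStep c β (fun h => ⨆ i, z i h) h
      ≤ (⨆ i, N.inBurst (z i) h) + ⨆ i, N.rate h.1 * N.tfaDelay c β (z i) (N.port h) := by
        unfold tfaStep
        rw [inBurst_iSup, ← ENNReal.mul_iSup]
        gcongr
    _ = ⨆ i, N.tfaStep c β (z i) h := by
        unfold tfaStep
        rw [ENNReal.iSup_add_iSup_of_monotone]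
        · exact fun i j hij => N.inBurst_mono (hmono hij) h
        · exact fun i j hij => mul_le_mul_right (N.tfaDelay_mono c le_rfl (hmono hij) _) _
    _ ≤ ⨆ i, z i h := iSup_le fun i => by
        have : N.tfaStep c β (z i) = z (i + 1) := by
          simp only [hz, Function.iterate_succ_apply']
        rw [this]
        exact le_iSup (fun i => z i h) (i + 1)

/-! ### Monotonicity and convergence of the algorithm -/

theorem serviceIter_le (m : ℕ → V → ℕ∞) (k : ℕ) (c : Fin n) (v : V) :
    N.serviceIter m k c v ≤ N.aggService v := by
  cases k with
  | zero => exact N.cdm_le v c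
  | succ k => exact N.drrService_le v _ _ c

theorem serviceIter_ne_top (m : ℕ → V → ℕ∞) (k : ℕ) (c : Fin n) (v : V) (t : ℝ≥0) :
    N.serviceIter m k c v t ≠ ⊤ :=
  ne_top_of_le_ne_top (N.aggService_ne_top v t) (N.serviceIter_le m k c v t)

theorem serviceIter_monotone (m : ℕ → V → ℕ∞) (k : ℕ) (c : Fin n) (v : V) :
    Monotone (N.serviceIter m k c v) := by
  cases k with
  | zero => exact N.cdm_monotone v c
  | succ k => exact N.drrService_monotone v _ _ c

theorem serviceIter_mono_index {m : ℕ → V → ℕ∞} (hm : ∀ v, Monotone fun k => m k v) :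
    Monotone (N.serviceIter m) := by
  refine monotone_nat_of_le_succ fun k => ?_
  induction k with
  | zero => exact fun c v => N.cdm_le_drrService v _ _ c
  | succ k ih =>
    exact fun c v => N.drrService_mono v (hm v (Nat.le_succ k)) (fun c' =>
      N.arrivalCurve_mono c' (N.genericTFA_snd_mono c' (ih c')) v) c

theorem algorithm_converges {m : ℕ → V → ℕ∞} (hm : ∀ v, Monotone fun k => m k v)
    (Ecut : Fin n → Set (V × V)) : Bounds.Converges fun k => N.algorithm m Ecut k := by
  have hβ := N.serviceIter_mono_index hm
  have hz : ∀ c h, Antitone fun k => (N.genericTFA c (N.serviceIter m k c)).2 h :=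
    fun c h i j hij => N.genericTFA_snd_mono c (hβ hij c) h
  have hd : ∀ c v, Antitone fun k => (N.genericTFA c (N.serviceIter m k c)).1 v :=
    fun c v i j hij => N.genericTFA_fst_mono c (hβ hij c) v
  refine ⟨⟨fun c v t => ⨆ k, N.serviceIter m k c v t,
    fun c v => ⨅ k, (N.genericTFA c (N.serviceIter m k c)).1 v,
    fun c h => ⨅ k, (N.genericTFA c (N.serviceIter m k c)).2 h,
    fun c h => ⨅ k, (N.genericTFA c (N.serviceIter m k c)).2 h,
    fun c e => ⨅ k, ∑ h ∈ N.hopsOn c e, (N.genericTFA c (N.serviceIter m k c)).2 h,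
    fun c v => ⨅ k, ∑ h ∈ N.hopsAt c v, (N.genericTFA c (N.serviceIter m k c)).2 h⟩,
    fun c v t => ⟨?_, ?_⟩, fun c v => tendsto_atTop_iInf (hd c v),
    fun c h => tendsto_atTop_iInf (hz c h), fun c h => tendsto_atTop_iInf (hz c h),
    fun c e => tendsto_atTop_iInf fun i j hij => Finset.sum_le_sum fun h _ => hz c h hij,
    fun c v => tendsto_atTop_iInf fun i j hij => Finset.sum_le_sum fun h _ => hz c h hij⟩
  · exact ne_top_of_le_ne_top (N.aggService_ne_top v t)
      (iSup_le fun k => N.serviceIter_le m k c v t)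
  · exact tendsto_atTop_iSup fun i j hij => hβ hij c v t

end Network

namespace ServerTrace

variable {n : ℕ} {J : Type}

/-! ### Runs of the scheduler -/

/-- Packets of class `c`. -/
def ofClass (X : ServerTrace n J) (c : Fin n) : Set J := {j | X.cls j = c}

/-- Number of bits of the packets of `S` that are served in `(s, t]`. -/
def servedBits (X : ServerTrace n J) (S : Set J) (s t : ℝ≥0) : ℝ≥0∞ :=
  ∑' j : S, ((X.served j t : ℝ≥0∞) - X.served j s)

/-- Number of bits of class `x` that are transmitted in a step with label `o`. -/
def sentBits (X : ServerTrace n J) (o : Option J) (x : Fin n) : ℝ≥0 :=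
  o.elim 0 fun j => if X.cls j = x then X.size j else 0

/-- The data whose existence `IsDRR` asserts. -/
structure IsRun [NeZero n] (X : ServerTrace n J) (Q : Fin n → ℝ≥0) (before : J → J → Prop)
    (time : ℕ → ℝ≥0) (state : ℕ → SchedulerState n J) (tx : ℕ → Option J) : Prop where
  order : IsStrictTotalOrder J before
  before_of_arr_lt : ∀ i j, X.arr i < X.arr j → before i j
  time_zero : time 0 = 0
  state_zero : ∃ c, state 0 = ⟨c, false, fun _ => 0, ∅⟩
  step : ∀ i, X.Step Q before (time i) (state i) (tx i) (time (i + 1)) (state (i + 1))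
  tendsto_time : Filter.Tendsto time Filter.atTop Filter.atTop
  transmitted : ∀ i j, tx i = some j → X.TransmittedDuring j (time i) (time (i + 1))
  untransmitted : ∀ j, (∀ i, tx i ≠ some j) → X.dep j = ⊤ ∧ ∀ u, X.served j u = 0

theorem IsDRR.exists_isRun [NeZero n] {X : ServerTrace n J} {Q : Fin n → ℝ≥0} (h : X.IsDRR Q) :
    ∃ before time state tx, X.IsRun Q before time state tx := by
  obtain ⟨before, time, state, tx, h1, h2, h3, h4, h5, h6, h7, h8⟩ := h
  exact ⟨before, time, state, tx, h1, h2, h3, h4, h5, h6, h7, h8⟩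

/-- The properties of a FIFO-per-class server on which the network-calculus bounds rest. -/
structure IsFIFO (X : ServerTrace n J) : Prop where
  served_mono : ∀ j, Monotone (X.served j)
  served_eq_zero : ∀ j (u : ℝ≥0), (u : ℝ≥0∞) ≤ X.arr j → X.served j u = 0
  served_lt : ∀ j (u : ℝ≥0), (u : ℝ≥0∞) < X.dep j → X.served j u < X.size j
  served_eq : ∀ j (u : ℝ≥0), X.dep j ≤ u → X.served j u = X.size j
  arr_lt_dep : ∀ j, X.arr j ≠ ⊤ → X.arr j < X.dep j
  arr_le_dep : ∀ j, X.arr j ≤ X.dep j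
  fifo : ∀ i j (u : ℝ≥0), X.cls i = X.cls j → X.arr i < X.arr j → 0 < X.served j u → X.dep i ≤ u

/-- A transmission takes the bits it sends from the deficit of their class. -/
theorem sentBits_add_update {X : ServerTrace n J} {c : Fin n} {δ : Fin n → ℝ≥0} {j : J}
    (hj : X.cls j = c) (hsize : X.size j ≤ δ c) (x : Fin n) :
    X.sentBits (some j) x + Function.update δ c (δ c - X.size j) x = δ x := by
  by_cases hx : x = c
  · subst hx
    simp [sentBits, hj, add_tsub_cancel_of_le hsize]
  · have : X.cls j ≠ x := fun h => hx (h ▸ hj)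
    simp [sentBits, hx, this]

section Run

variable [NeZero n] {X : ServerTrace n J} {Q : Fin n → ℝ≥0} {before : J → J → Prop}
  {t t' : ℝ≥0} {σ σ' : SchedulerState n J} {o : Option J}

theorem Step.time_le (h : X.Step Q before t σ o t' σ') : t ≤ t' := by
  cases h with
  | skip _ _ _ _ _ ht _ => exact ht
  | begin_service => exact le_rfl
  | send _ _ _ _ _ _ _ ht => exact ht.le
  | close_deficit => exact le_rfl
  | close_empty => exact le_rfl

theorem Step.mem_sent (h : X.Step Q before t σ o t' σ') (j : J) :
    j ∈ σ'.sent ↔ j ∈ σ.sent ∨ o = some j := by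
  cases h <;> simp [or_comm, eq_comm]

theorem Step.isHead {j : J} (h : X.Step Q before t σ (some j) t' σ') :
    X.IsHead before σ.ptr t σ.sent j := by
  cases h with
  | send _ _ _ _ _ hj _ _ => exact hj

theorem Step.sentBits_le (h : X.Step Q before t σ o t' σ') (x : Fin n) :
    X.sentBits o x ≤ σ.deficit x := by
  cases h with
  | send _ c δ S j hj hsize ht =>
    simp only [sentBits, Option.elim_some]
    split_ifs with hx
    · rwa [← hx, hj.1.1]
    · exact zero_le
  | _ => exact zero_le

variable {time : ℕ → ℝ≥0} {state : ℕ → SchedulerState n J} {tx : ℕ → Option J}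

namespace IsRun

theorem time_mono (hr : X.IsRun Q before time state tx) : Monotone time :=
  monotone_nat_of_le_succ fun i => (hr.step i).time_le

theorem mem_sent (hr : X.IsRun Q before time state tx) (i : ℕ) (j : J) :
    j ∈ (state i).sent ↔ ∃ k < i, tx k = some j := by
  induction i with
  | zero =>
    obtain ⟨c, hc⟩ := hr.state_zero
    simp [hc]
  | succ i ih =>
    rw [(hr.step i).mem_sent, ih]
    simp only [Nat.lt_succ_iff_lt_or_eq, or_and_right, exists_or, exists_eq_left]

theorem dep_le_of_mem_sent (hr : X.IsRun Q before time state tx) {i : ℕ} {j : J}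
    (hj : j ∈ (state i).sent) : X.dep j ≤ time i := by
  obtain ⟨k, hk, hkj⟩ := (hr.mem_sent i j).1 hj
  rw [(hr.transmitted k j hkj).1]
  exact_mod_cast hr.time_mono hk

theorem isFIFO (hr : X.IsRun Q before time state tx) (hsize : ∀ j, 0 < X.size j) : X.IsFIFO := by
  have key : ∀ j, (∃ i, tx i = some j) ∨ (X.dep j = ⊤ ∧ ∀ u, X.served j u = 0) := fun j => by
    by_cases h : ∃ i, tx i = some j
    · exact Or.inl h
    · push Not at h
      exact Or.inr (hr.untransmitted j h)
  have harr : ∀ i j, tx i = some j → X.arr j ≤ time i := fun i j h =>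
    ((h ▸ hr.step i : X.Step Q before _ _ (some j) _ _).isHead).1.2.1
  have hlt : ∀ i j, tx i = some j → time i < time (i + 1) := fun i j h => by
    have h1 : X.Step Q before _ _ (some j) _ _ := h ▸ hr.step i
    generalize state i = σ, state (i + 1) = σ' at h1
    generalize time i = t, time (i + 1) = t' at h1 ⊢
    cases h1 with
    | send _ _ _ _ _ _ _ ht => exact ht
  refine ⟨fun j => ?_, fun j u hu => ?_, fun j u hu => ?_, fun j u hu => ?_, fun j hj => ?_,
    fun j => ?_, fun i j u hc hij hu => ?_⟩
  · rcases key j with ⟨i, hi⟩ | ⟨-, h⟩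
    · exact (hr.transmitted i j hi).2.1
    · exact fun a b _ => by rw [h, h]
  · rcases key j with ⟨i, hi⟩ | ⟨-, h⟩
    · exact (hr.transmitted i j hi).2.2.1 u (by exact_mod_cast hu.trans (harr i j hi))
    · exact h u
  · rcases key j with ⟨i, hi⟩ | ⟨-, h⟩
    · have := hr.transmitted i j hi
      rw [this.1] at hu
      exact this.2.2.2.1 u (by exact_mod_cast hu)
    · rw [h]; exact hsize j
  · rcases key j with ⟨i, hi⟩ | ⟨h, -⟩
    · have := hr.transmitted i j hi
      rw [this.1] at hu
      exact this.2.2.2.2 u (by exact_mod_cast hu)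
    · rw [h] at hu; exact absurd hu (by simp)
  · rcases key j with ⟨i, hi⟩ | ⟨h, -⟩
    · rw [(hr.transmitted i j hi).1]
      exact (harr i j hi).trans_lt (by exact_mod_cast hlt i j hi)
    · rw [h]; exact hj.lt_top
  · rcases key j with ⟨i, hi⟩ | ⟨h, -⟩
    · rw [(hr.transmitted i j hi).1]
      exact (harr i j hi).trans (by exact_mod_cast (hlt i j hi).le)
    · rw [h]; exact le_top
  · rcases key j with ⟨k, hk⟩ | ⟨-, h⟩
    · have hku : time k ≤ u := by
        by_contra! hlt'
        rw [(hr.transmitted k j hk).2.2.1 u hlt'.le] at hu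
        exact lt_irrefl _ hu
      have hhead := (hk ▸ hr.step k : X.Step Q before _ _ (some j) _ _).isHead
      -- an earlier packet of the same queue that were still waiting would be the head
      have hmem : i ∈ (state k).sent := by
        by_contra hi
        have := hr.order
        have hbef := hr.before_of_arr_lt i j hij
        rcases hhead.2 i ⟨hc.trans hhead.1.1, hij.le.trans (harr k j hk), hi⟩ with h | h
        · exact absurd hij (h ▸ lt_irrefl _)
        · exact irrefl_of before i (trans_of before hbef h)
      exact (hr.dep_le_of_mem_sent hmem).trans (by exact_mod_cast hku)
    · rw [h] at hu; exact absurd hu (lt_irrefl _)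

end IsRun

end Run

/-! ### Bits served in an interval -/

section ServedBits

variable {X : ServerTrace n J} {S : Set J} {s t u : ℝ≥0}

theorem servedBits_self : X.servedBits S s s = 0 := by
  simp [servedBits]

theorem servedBits_add (hm : ∀ j, Monotone (X.served j)) (h1 : s ≤ t) (h2 : t ≤ u) :
    X.servedBits S s t + X.servedBits S t u = X.servedBits S s u := by
  unfold servedBits
  rw [← ENNReal.tsum_add]
  refine tsum_congr fun j => ?_
  norm_cast
  rw [add_comm]
  exact tsub_add_tsub_cancel (hm j h2) (hm j h1)

theorem servedBits_mono (hm : ∀ j, Monotone (X.served j)) {s' t' : ℝ≥0} (h1 : s' ≤ s)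
    (h2 : t ≤ t') : X.servedBits S s t ≤ X.servedBits S s' t' :=
  ENNReal.tsum_le_tsum fun j => by
    norm_cast
    exact tsub_le_tsub (hm j h2) (hm j h1)

theorem servedBits_univ : X.servedBits Set.univ s t = ∑ c, X.servedBits (X.ofClass c) s t := by
  unfold servedBits
  rw [tsum_univ (fun j => ((X.served j t : ℝ≥0∞) - X.served j s))]
  have : ∀ c, ∑' j : X.ofClass c, ((X.served j t : ℝ≥0∞) - X.served j s)
      = ∑' j, (X.ofClass c).indicator (fun j => (X.served j t : ℝ≥0∞) - X.served j s) j :=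
    fun c => tsum_subtype _ (fun j => ((X.served j t : ℝ≥0∞) - X.served j s))
  simp only [this]
  rw [← Summable.tsum_finsetSum fun _ _ => ENNReal.summable]
  refine tsum_congr fun j => ?_
  have hite : ∀ c, (X.ofClass c).indicator (fun j => (X.served j t : ℝ≥0∞) - X.served j s) j
      = if X.cls j = c then (X.served j t : ℝ≥0∞) - X.served j s else 0 := fun c => by
    split_ifs with h
    · exact Set.indicator_of_mem (show j ∈ X.ofClass c from h) _
    · exact Set.indicator_of_notMem (show j ∉ X.ofClass c from h) _
  rw [Finset.sum_congr rfl fun c _ => hite c, Finset.sum_ite_eq, if_pos (Finset.mem_univ _)]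

theorem Backlogged.mono {S' : Set J} (h : S ⊆ S') (hb : X.Backlogged S u) :
    X.Backlogged S' u := by
  obtain ⟨j, hj, h1, h2⟩ := hb
  exact ⟨j, h hj, h1, h2⟩

end ServedBits

/-! ### Deficits -/

/-- Packet sizes and quanta are multiples of `ε`, and `l` bounds the packet sizes of every class. -/
structure UnitSizes (X : ServerTrace n J) (Q l : Fin n → ℝ≥0) (ε : ℝ≥0) : Prop where
  quantum : ∀ c, ∃ m : ℕ, Q c = m * ε
  eps_le : ∀ c, ε ≤ l c
  size : ∀ j, ∃ m : ℕ, 0 < m ∧ X.size j = m * ε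
  size_le : ∀ j, X.size j ≤ l (X.cls j)

/-- Deficits are multiples of `ε`; the deficit of a class that is not in service is at most
`l c - ε`, and a service raises this bound by the quantum. -/
def DeficitBound (Q l : Fin n → ℝ≥0) (ε : ℝ≥0) (σ : SchedulerState n J) : Prop :=
  ∀ x, (∃ m : ℕ, σ.deficit x = m * ε) ∧
    σ.deficit x + ε ≤ l x + if σ.serving ∧ σ.ptr = x then Q x else 0

section Rounds

/-! ### Counting the rounds of the scheduler -/

/-- Position of the scheduler in a round that starts when class `c` enters service: twice the cyclic
distance from `c` to the visited queue, plus one during a service. The end of the round, when `c` is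
visited but not yet in service, has position `2 n`. -/
def roundPos (c : Fin n) (σ : SchedulerState n J) : ℕ :=
  if σ.ptr = c ∧ σ.serving = false then 2 * n
  else 2 * (σ.ptr - c : Fin n).val + if σ.serving then 1 else 0

/-- In the present round of class `c`, the service of class `j` has started, or its queue was found
empty. -/
def Passed (c : Fin n) (σ : SchedulerState n J) (j : Fin n) : Prop :=
  2 * (j - c : Fin n).val < roundPos c σ

theorem passed_serving_self {c j : Fin n} {σ : SchedulerState n J}
    (h : σ.serving = true) (hp : σ.ptr = j) : Passed c σ j := by
  simp [Passed, roundPos, h, hp]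

theorem Passed.of_begin {c j x : Fin n} {δ δ' : Fin n → ℝ≥0} {S : Set J} (hx : x ≠ c)
    (h : Passed c ⟨x, false, δ, S⟩ j) : Passed c ⟨x, true, δ', S⟩ j := by
  simp only [Passed, roundPos, hx, false_and, if_false, Bool.false_eq_true, if_true] at h ⊢
  omega

variable [NeZero n]

theorem val_sub_pos {x c : Fin n} (h : x ≠ c) : 0 < (x - c : Fin n).val := by
  rw [Nat.pos_iff_ne_zero, Ne, Fin.val_eq_zero_iff, sub_eq_zero]
  exact h

theorem val_succ_sub (x c : Fin n) : ((x + 1 - c : Fin n).val = (x - c : Fin n).val + 1) ∨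
    ((x - c : Fin n).val + 1 = n ∧ x + 1 = c) := by
  rw [add_sub_right_comm]
  by_cases h : (x - c : Fin n).val + 1 = n
  · refine Or.inr ⟨h, ?_⟩
    rw [← sub_eq_zero, add_sub_right_comm, ← Fin.val_eq_zero_iff, Fin.val_add, Fin.val_one',
      Nat.add_mod_mod, h, Nat.mod_self]
  · left
    have := (x - c : Fin n).isLt
    rw [Fin.val_add, Fin.val_one', Nat.add_mod_mod, Nat.mod_eq_of_lt (by omega)]

theorem not_passed_start {c j : Fin n} {σ : SchedulerState n J}
    (h : σ.serving = true) (hp : σ.ptr = c) (hj : j ≠ c) : ¬ Passed c σ j := by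
  have := val_sub_pos hj
  simp only [Passed, roundPos, h, hp, Bool.true_eq_false, and_false, if_false, if_true, sub_self,
    Fin.val_zero]
  omega

/-- Leaving a queue does not skip any class but the one just visited. -/
theorem Passed.of_succ {c j x : Fin n} {δ δ' : Fin n → ℝ≥0} {S S' : Set J} (b : Bool)
    (hx : x ≠ c ∨ b = true) (h : Passed c ⟨x, b, δ, S⟩ j) :
    Passed c ⟨x + 1, false, δ', S'⟩ j := by
  have h1 := (j - c).isLt
  have h2 := val_succ_sub x c
  simp only [Passed, roundPos, and_true, Bool.false_eq_true, if_false, add_zero] at h ⊢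
  rw [if_neg (by rcases hx with h | h <;> simp [h])] at h
  split_ifs with h3
  · omega
  · rcases h2 with h2 | h2
    · rw [h2]; cases b <;> simp at h ⊢ <;> omega
    · exact absurd h2.2 h3

end Rounds

/-! ### Evolution of the deficits and of the rounds -/

section Run

variable [NeZero n] {X : ServerTrace n J} {Q l : Fin n → ℝ≥0} {ε : ℝ≥0} {before : J → J → Prop}
  {t t' : ℝ≥0} {σ σ' : SchedulerState n J} {o : Option J}

theorem Step.deficitBound (hu : X.UnitSizes Q l ε) (h : X.Step Q before t σ o t' σ')
    (hσ : DeficitBound Q l ε σ) : DeficitBound Q l ε σ' := by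
  intro x
  obtain ⟨⟨m, hm⟩, hb⟩ := hσ x
  cases h with
  | skip => exact ⟨⟨m, hm⟩, by simpa using hb⟩
  | begin_service c δ S hne =>
    by_cases hx : c = x
    · subst hx
      obtain ⟨q, hq⟩ := hu.quantum c
      simp only [Function.update_self, and_self, if_true]
      simp only [Bool.false_eq_true, false_and, if_false, add_zero] at hb hm
      refine ⟨⟨m + q, by rw [hm, hq]; push_cast; ring⟩, ?_⟩
      calc δ c + Q c + ε = (δ c + ε) + Q c := by ring
        _ ≤ l c + Q c := by gcongr
    · simp only [Function.update_of_ne (Ne.symm hx), hx, and_false, if_false]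
      simp only [Bool.false_eq_true, false_and, if_false] at hb
      exact ⟨⟨m, hm⟩, hb⟩
  | send t' c δ S j hj hsize ht =>
    by_cases hx : c = x
    · subst hx
      obtain ⟨k, -, hk⟩ := hu.size j
      simp only [Function.update_self, and_self, if_true] at hb hm ⊢
      refine ⟨⟨m - k, ?_⟩, ?_⟩
      · rw [hm, hk, ← tsub_mul, Nat.cast_tsub]
      · exact (add_le_add_left tsub_le_self _).trans hb
    · refine ⟨⟨m, ?_⟩, ?_⟩
      · simpa [Function.update_of_ne (Ne.symm hx)] using hm
      · simpa [Function.update_of_ne (Ne.symm hx), hx] using hb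
  | close_deficit c δ S j hj hsize =>
    refine ⟨⟨m, hm⟩, ?_⟩
    by_cases hx : c = x
    · subst hx
      obtain ⟨k, -, hk⟩ := hu.size j
      simp only [Bool.false_eq_true, false_and, if_false, add_zero] at hm ⊢
      have hmk : m < k := by
        rw [hm, hk] at hsize
        exact_mod_cast lt_of_mul_lt_mul_right hsize zero_le
      calc δ c + ε = ((m + 1 : ℕ) : ℝ≥0) * ε := by rw [hm]; push_cast; ring
        _ ≤ k * ε := by gcongr; exact_mod_cast hmk
        _ ≤ l c := by rw [← hk]; exact (hu.size_le j).trans_eq (by rw [hj.1.1])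
    · simpa [hx] using hb
  | close_empty c δ S hempty =>
    by_cases hx : c = x
    · subst hx
      exact ⟨⟨0, by simp⟩, by simpa using hu.eps_le c⟩
    · simp only [Function.update_of_ne (Ne.symm hx)]
      exact ⟨⟨m, hm⟩, by simpa [hx] using hb⟩

theorem IsRun.deficitBound {time : ℕ → ℝ≥0} {state : ℕ → SchedulerState n J} {tx : ℕ → Option J}
    (hr : X.IsRun Q before time state tx) (hu : X.UnitSizes Q l ε) (i : ℕ) :
    DeficitBound Q l ε (state i) := by
  induction i with
  | zero =>
    obtain ⟨c, hc⟩ := hr.state_zero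
    intro x
    rw [hc]
    exact ⟨⟨0, by simp⟩, by simpa using hu.eps_le x⟩
  | succ i ih => exact (hr.step i).deficitBound hu ih

/-- Balance of the services since class `c` became backlogged, where `D x` bits of class `x` have
been served: `W` services of `c` have started, and at most `W + 1` of any other class, or `W` if the
class has not been visited yet in the present round. The deficits account for the part of the quanta
not spent yet. -/
def RoundBalance (Q d : Fin n → ℝ≥0) (c : Fin n) (D : Fin n → ℝ≥0∞) (σ : SchedulerState n J) :
    Prop :=
  ∃ W : ℕ, (W * Q c : ℝ≥0∞) ≤ D c + σ.deficit c ∧ ∀ j ≠ c,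
    D j + σ.deficit j ≤ (W + 1) * Q j + d j ∧
      (¬ Passed c σ j → D j + σ.deficit j ≤ W * Q j + d j)

/-- The balance is kept as long as class `c` is backlogged: then the scheduler neither skips `c` nor
resets its deficit. -/
theorem Step.roundBalance {d : Fin n → ℝ≥0} {c : Fin n} {D : Fin n → ℝ≥0∞}
    (h : X.Step Q before t σ o t' σ') (hc : ∃ j, X.Waiting c t σ.sent j)
    (hb : RoundBalance Q d c D σ) :
    RoundBalance Q d c (fun x => D x + X.sentBits o x) σ' := by
  obtain ⟨W, hW, hj⟩ := hb
  cases h with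
  | skip t' x δ S hempty ht hidle =>
    have hx : x ≠ c := fun h => hc.elim fun j hj => hempty j (h ▸ hj)
    refine ⟨W, by simpa [sentBits] using hW, fun j hjc => ⟨by simpa [sentBits] using (hj j hjc).1,
      fun hp => ?_⟩⟩
    simpa [sentBits] using (hj j hjc).2 fun h => hp (h.of_succ false (Or.inl hx))
  | begin_service x δ S hne =>
    simp only [sentBits, Option.elim_none, ENNReal.coe_zero, add_zero]
    by_cases hx : x = c
    · subst hx
      refine ⟨W + 1, ?_, fun j hjc => ?_⟩
      · simp only [Function.update_self]
        push_cast
        rw [add_mul, one_mul, ← add_assoc]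
        exact add_le_add_left hW _
      · simp only [Function.update_of_ne hjc]
        have h1 := (hj j hjc).1
        push_cast
        refine ⟨h1.trans ?_, fun _ => h1⟩
        gcongr
        exact le_self_add
    · refine ⟨W, by simpa [Function.update_of_ne (Ne.symm hx)] using hW, fun j hjc => ?_⟩
      by_cases hxj : x = j
      · subst hxj
        simp only [Function.update_self]
        refine ⟨?_, fun hp => absurd (passed_serving_self rfl rfl) hp⟩
        -- a service of `j` starts only when its queue has not been visited yet in this round
        have hnp : ¬ Passed c ⟨x, false, δ, S⟩ x := by
          simp [Passed, roundPos, hx]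
        have h1 := (hj x hjc).2 hnp
        push_cast
        calc D x + (δ x + Q x : ℝ≥0∞) = (D x + δ x) + Q x := by ring
          _ ≤ (W * Q x + d x) + Q x := by gcongr
          _ = (W + 1) * Q x + d x := by ring
      · simp only [Function.update_of_ne (Ne.symm hxj)]
        exact ⟨(hj j hjc).1, fun hp => (hj j hjc).2 fun h => hp (h.of_begin hx)⟩
  | send t' x δ S k hk hsize ht =>
    have hδ : ∀ y, (X.sentBits (some k) y : ℝ≥0∞) +
        (Function.update δ x (δ x - X.size k) y : ℝ≥0) = δ y := fun y => by
      rw [← ENNReal.coe_add, sentBits_add_update hk.1.1 hsize]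
    refine ⟨W, ?_, fun j hjc => ?_⟩
    · simpa only [add_assoc, hδ] using hW
    · simp only [add_assoc, hδ]
      exact hj j hjc
  | close_deficit x δ S k hk hsize =>
    refine ⟨W, by simpa [sentBits] using hW, fun j hjc => ⟨by simpa [sentBits] using (hj j hjc).1,
      fun hp => ?_⟩⟩
    simpa [sentBits] using (hj j hjc).2 fun h => hp (h.of_succ true (Or.inr rfl))
  | close_empty x δ S hempty =>
    have hx : x ≠ c := fun h => hc.elim fun j hj => hempty j (h ▸ hj)
    have hδ : ∀ y, Function.update δ x 0 y ≤ δ y := fun y => by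
      by_cases hy : y = x
      · subst hy; simp
      · simp [Function.update_of_ne hy]
    have hle : ∀ y, D y + (X.sentBits (none : Option J) y : ℝ≥0∞) + (Function.update δ x 0 y : ℝ≥0)
        ≤ D y + δ y := fun y => by
      simpa [sentBits] using add_le_add_right (ENNReal.coe_le_coe.2 (hδ y)) (D y)
    refine ⟨W, by simpa [sentBits, Function.update_of_ne (Ne.symm hx)] using hW,
      fun j hjc => ⟨(hle j).trans (hj j hjc).1, fun hp => (hle j).trans ?_⟩⟩
    exact (hj j hjc).2 fun h => hp (h.of_succ true (Or.inr rfl))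

/-! ### Service of a backlogged class -/

section Backlog

variable {time : ℕ → ℝ≥0} {state : ℕ → SchedulerState n J} {tx : ℕ → Option J}

theorem IsRun.exists_waiting (hr : X.IsRun Q before time state tx) {c : Fin n} {i : ℕ} {u : ℝ≥0}
    (hi : time i ≤ u) (hb : X.Backlogged (X.ofClass c) u) :
    ∃ j, X.Waiting c u (state i).sent j := by
  obtain ⟨j, hj, h1, h2⟩ := hb
  refine ⟨j, hj, h1, fun h => ?_⟩
  exact absurd ((hr.dep_le_of_mem_sent h).trans (by exact_mod_cast hi)) (not_le_of_gt h2)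

theorem IsRun.servedBits_step (hr : X.IsRun Q before time state tx) (x : Fin n) (i : ℕ) :
    X.servedBits (X.ofClass x) (time i) (time (i + 1)) = X.sentBits (tx i) x := by
  have hconst : ∀ j, tx i ≠ some j → X.served j (time (i + 1)) = X.served j (time i) := by
    intro j hj
    by_cases h : ∃ k, tx k = some j
    · obtain ⟨k, hk⟩ := h
      have htr := hr.transmitted k j hk
      rcases lt_trichotomy k i with hki | rfl | hki
      · have h1 : time (k + 1) ≤ time i := hr.time_mono hki
        rw [htr.2.2.2.2 _ h1, htr.2.2.2.2 _ (h1.trans (hr.time_mono (Nat.le_succ i)))]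
      · exact absurd hk hj
      · have h1 : time (i + 1) ≤ time k := hr.time_mono hki
        rw [htr.2.2.1 _ h1, htr.2.2.1 _ ((hr.time_mono (Nat.le_succ i)).trans h1)]
    · push Not at h
      have := (hr.untransmitted j h).2
      rw [this, this]
  unfold servedBits
  rcases hi : tx i with _ | k
  · simp only [sentBits, Option.elim_none, ENNReal.coe_zero, ENNReal.tsum_eq_zero]
    exact fun j => by rw [hconst j (by simp [hi])]; simp
  · simp only [sentBits, Option.elim_some]
    split_ifs with hk
    · rw [tsum_eq_single (⟨k, hk⟩ : X.ofClass x)]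
      · have htr := hr.transmitted i k hi
        simp [htr.2.2.1 _ le_rfl, htr.2.2.2.2 _ le_rfl]
      · intro j hj
        rw [hconst j (by rw [hi]; exact fun h => hj (Subtype.ext (Option.some.inj h).symm))]
        simp
    · simp only [ENNReal.coe_zero, ENNReal.tsum_eq_zero]
      refine fun j => ?_
      rw [hconst j (by rw [hi]; exact fun h => hk (by rw [Option.some.inj h]; exact j.2))]
      simp

/-- A scheduler step that starts before time `u` and ends after it is a transmission if some packet
is waiting at time `u`. -/
theorem Step.serving_of_waiting {c : Fin n} {u : ℝ≥0} (h : X.Step Q before t σ o t' σ')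
    (h1 : t ≤ u) (h2 : u < t') (hw : ∃ j, X.Waiting c u σ.sent j) :
    σ.serving = true ∧ σ'.serving = true ∧ σ'.ptr = σ.ptr ∧
      ∀ x, X.sentBits o x + σ'.deficit x = σ.deficit x := by
  cases h with
  | skip t' x δ S hempty ht hidle => exact hw.elim fun j hj => absurd hj (hidle u h1 h2 c j)
  | send t' x δ S k hk hsize ht => exact ⟨rfl, rfl, rfl, sentBits_add_update hk.1.1 hsize⟩
  | _ => exact absurd h2 (not_lt_of_ge h1)

/-- While class `c` is backlogged, any other class is served at most one quantum and one residual
deficit more than the number `p` of quanta that `c` is served, up to a residual deficit. -/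
theorem IsRun.exists_rounds (hr : X.IsRun Q before time state tx) (hF : X.IsFIFO)
    (hu : X.UnitSizes Q l ε) {c : Fin n} {s t : ℝ≥0} (hst : s ≤ t)
    (hb : ∀ u, s ≤ u → u < t → X.Backlogged (X.ofClass c) u) :
    ∃ p : ℕ, (p * Q c : ℝ≥0∞) ≤ X.servedBits (X.ofClass c) s t + (l c - ε : ℝ≥0) ∧
      ∀ j ≠ c, X.servedBits (X.ofClass j) s t ≤ (p + 1) * Q j + (l j - ε : ℝ≥0) := by
  have hm := hF.served_mono
  rcases hst.eq_or_lt with rfl | hlt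
  · exact ⟨0, by simp, fun j _ => by simp [servedBits_self]⟩
  have hstep : ∀ i x u w, time i ≤ u → w ≤ time (i + 1) →
      X.servedBits (X.ofClass x) u w ≤ X.sentBits (tx i) x := fun i x u w h1 h2 =>
    (servedBits_mono hm h1 h2).trans_eq (hr.servedBits_step x i)
  have hdef : ∀ i x, (state i).deficit x ≤
      (l x - ε) + if (state i).serving ∧ (state i).ptr = x then Q x else 0 := fun i x => by
    have h1 := ((hr.deficitBound hu i) x).2
    rw [← add_le_add_iff_right ε]
    refine h1.trans (le_of_eq ?_)
    rw [add_right_comm, tsub_add_cancel_of_le (hu.eps_le x)]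
  have hex : ∀ a, ∃ i, a < time i := fun a => by
    obtain ⟨i, hi⟩ := (hr.tendsto_time.eventually_gt_atTop a).exists
    exact ⟨i, hi⟩
  -- `i + 1` is the first step that starts after `s`, and step `k` is the one that reaches `t`
  obtain ⟨i, hi, hi'⟩ : ∃ i, time i ≤ s ∧ s < time (i + 1) := by
    classical
    have h0 : Nat.find (hex s) ≠ 0 := fun h => by
      have := Nat.find_spec (hex s)
      rw [h, hr.time_zero] at this
      exact not_lt_zero this
    obtain ⟨i, hi⟩ := Nat.exists_eq_succ_of_ne_zero h0
    refine ⟨i, not_lt.1 (Nat.find_min (hex s) (by omega)), ?_⟩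
    have := Nat.find_spec (hex s)
    rwa [hi] at this
  obtain ⟨k, hk, hk'⟩ : ∃ k, time k < t ∧ t ≤ time (k + 1) := by
    classical
    have hex' : ∃ i, t ≤ time i := (hex t).imp fun _ h => h.le
    have h0 : Nat.find hex' ≠ 0 := fun h => by
      have := Nat.find_spec hex'
      rw [h, hr.time_zero] at this
      exact not_lt_zero (hlt.trans_le this)
    obtain ⟨k, hk⟩ := Nat.exists_eq_succ_of_ne_zero h0
    refine ⟨k, not_le.1 (Nat.find_min hex' (by omega)), ?_⟩
    have := Nat.find_spec hex'
    rwa [hk] at this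
  have hik : i ≤ k := by
    by_contra! h
    exact absurd (hk'.trans (hr.time_mono (show k + 1 ≤ i from h))) (not_le_of_gt (hi.trans_lt hlt))
  obtain ⟨hs1, hs2, hs3, hs4⟩ := (hr.step i).serving_of_waiting hi hi'
    (hr.exists_waiting hi (hb s le_rfl hlt))
  rcases hik.eq_or_lt with rfl | hik
  · -- the whole interval lies within one transmission
    refine ⟨0, by simp, fun j _ => ?_⟩
    have h1 := (hstep i j s t hi hk').trans
      (ENNReal.coe_le_coe.2 (((hr.step i).sentBits_le j).trans (hdef i j)))
    refine h1.trans ?_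
    rw [Nat.cast_zero, zero_add, one_mul, add_comm]
    norm_cast
    gcongr
    split_ifs
    · exact le_rfl
    · exact zero_le
  have hbal : ∀ q, i + 1 ≤ q → q ≤ k →
      RoundBalance Q (fun x => l x - ε) c (fun x => X.servedBits (X.ofClass x) s (time q))
        (state q) := by
    intro q hq
    induction q, hq using Nat.le_induction with
    | base =>
      intro _
      have h1 : ∀ x, X.servedBits (X.ofClass x) s (time (i + 1)) + (state (i + 1)).deficit x
          ≤ ((l x - ε : ℝ≥0) : ℝ≥0∞) + (if (state i).ptr = x then Q x else 0 : ℝ≥0) := by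
        intro x
        calc X.servedBits (X.ofClass x) s (time (i + 1)) + (state (i + 1)).deficit x
            ≤ X.sentBits (tx i) x + (state (i + 1)).deficit x := by
              gcongr
              exact hstep i x _ _ hi le_rfl
          _ = (state i).deficit x := by exact_mod_cast hs4 x
          _ ≤ _ := by
              have := hdef i x
              simp only [hs1, true_and] at this
              exact_mod_cast this
      refine ⟨0, by simp, fun j hj => ⟨?_, fun hp => ?_⟩⟩
      · refine (h1 j).trans ?_
        rw [Nat.cast_zero, zero_add, one_mul, add_comm]
        gcongr
        split_ifs
        · exact le_rfl
        · exact zero_le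
      · have hne : (state i).ptr ≠ j := fun h =>
          hp (passed_serving_self hs2 (hs3.trans h))
        simpa [hne] using h1 j
    | succ q hq ih =>
      intro hqk
      have hq1 : s ≤ time q := hi'.le.trans (hr.time_mono hq)
      have hq2 : time q < t := (hr.time_mono (by omega : q ≤ k)).trans_lt hk
      have := (hr.step q).roundBalance (hr.exists_waiting le_rfl (hb _ hq1 hq2)) (ih (by omega))
      simpa only [← hr.servedBits_step, servedBits_add hm hq1 (hr.time_mono (Nat.le_succ q))]
        using this
  obtain ⟨W, hW, hj⟩ := hbal k hik le_rfl
  have hsk : s ≤ time k := hi'.le.trans (hr.time_mono hik)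
  have hup : ∀ j, X.servedBits (X.ofClass j) s t ≤
      X.servedBits (X.ofClass j) s (time k) + (state k).deficit j := fun j => by
    rw [← servedBits_add hm hsk hk.le]
    gcongr
    exact (hstep k j _ _ le_rfl hk').trans (ENNReal.coe_le_coe.2 ((hr.step k).sentBits_le j))
  have hlow : (W * Q c : ℝ≥0∞) ≤ X.servedBits (X.ofClass c) s t + ((l c - ε : ℝ≥0) +
      (if (state k).serving ∧ (state k).ptr = c then Q c else 0 : ℝ≥0)) := by
    refine hW.trans (add_le_add (servedBits_mono hm le_rfl hk.le) ?_)
    exact_mod_cast hdef k c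
  by_cases hc : (state k).serving ∧ (state k).ptr = c
  · -- the last service of `c` need not be complete, but no other class was visited since it began
    rw [if_pos hc] at hlow
    have hj' : ∀ j ≠ c, X.servedBits (X.ofClass j) s t ≤ W * Q j + (l j - ε : ℝ≥0) := fun j hjc =>
      (hup j).trans ((hj j hjc).2 (not_passed_start hc.1 hc.2 hjc))
    rcases W with _ | W
    · refine ⟨0, by simp, fun j hjc => (hj' j hjc).trans ?_⟩
      gcongr
      exact le_self_add
    · refine ⟨W, ?_, fun j hjc => by simpa using hj' j hjc⟩
      rw [Nat.cast_succ, add_mul, one_mul, ← add_assoc] at hlow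
      exact (ENNReal.add_le_add_iff_right ENNReal.coe_ne_top).1 hlow
  · rw [if_neg hc] at hlow
    exact ⟨W, by simpa using hlow, fun j hjc => (hup j).trans (hj j hjc).1⟩

end Backlog

end Run

end ServerTrace

/-! ### From rounds to service curves -/

namespace Network

variable {n : ℕ} {V F : Type} (N : Network n V F)

/-- If the competing classes in `J` are served at most `p + 1` quanta and a residual deficit each, and
`y` is at least `p` quanta of class `c` up to a residual deficit, then the service curve holds: the
first rate-latency function results from replacing `p` by its real upper bound `(y + d_c) / Q_c`, the
second one from `p (Q_c - d_c) ≤ y`, which also uses that `p` is a natural number. -/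
theorem gammaConvex_le_of_rounds {v : V} {c : Fin n} {J : Finset (Fin n)} {x y : ℝ≥0∞} {p : ℕ}
    {D : Fin n → ℝ≥0∞} (hx : x ≤ y + ∑ j ∈ J, D j)
    (hp : (p * N.quantum v c : ℝ≥0∞) ≤ y + N.dmax v c)
    (hD : ∀ j ∈ J, D j ≤ (p + 1) * N.quantum v j + N.dmax v j) :
    N.gammaConvex v c J x ≤ y := by
  induction y with
  | top => exact le_top
  | coe y =>
  have hq := N.quantum_pos v c
  have hd : N.dmax v c ≤ N.quantum v c := N.residual_le v c
  have hpy : (p : ℝ≥0) * N.quantum v c ≤ y + N.dmax v c := by exact_mod_cast hp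
  set q := N.quantum v c
  set d := N.dmax v c
  set A := ∑ j ∈ J, N.quantum v j with hA
  set B := ∑ j ∈ J, N.dmax v j with hB
  have hx' : x ≤ ((y + ((p + 1) * A + B) : ℝ≥0) : ℝ≥0∞) := by
    refine hx.trans ?_
    rw [ENNReal.coe_add, hA, hB, Finset.mul_sum, ← Finset.sum_add_distrib,
      ENNReal.ofNNReal_finsetSum]
    refine add_le_add_right (Finset.sum_le_sum fun j hj => ?_) _
    exact_mod_cast hD j hj
  have hT1 : ∑ j ∈ J, (N.quantum v j + N.dmax v j + N.quantum v j / q * d)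
      = A + B + A / q * d := by
    rw [Finset.sum_add_distrib, Finset.sum_add_distrib, ← Finset.sum_mul, ← Finset.sum_div]
  have hT2 : ∑ j ∈ J, (N.quantum v j + N.dmax v j) = A + B := Finset.sum_add_distrib
  refine (N.gammaConvex_mono v c J hx').trans ?_
  unfold gammaConvex
  rw [hT1, hT2]
  have hcoe : ∀ R T z : ℝ≥0, R * (z - T) ≤ y → rateLatency R T (z : ℝ≥0∞) ≤ y := fun R T z h => by
    unfold rateLatency
    exact_mod_cast h
  refine max_le (hcoe _ _ _ ?_) (hcoe _ _ _ ?_)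
  · have h1 : y + ((p + 1) * A + B) - (A + B + A / q * d) ≤ y * ((q + A) / q) := by
      rw [tsub_le_iff_right]
      have h2 : p * A ≤ A / q * (y + d) := by
        calc p * A = A / q * (p * q) := by field_simp
          _ ≤ A / q * (y + d) := by gcongr
      calc y + ((p + 1) * A + B) = p * A + (y + A + B) := by ring
        _ ≤ A / q * (y + d) + (y + A + B) := by gcongr
        _ = y * ((q + A) / q) + (A + B + A / q * d) := by field_simp; ring
    calc q / (q + A) * (y + ((p + 1) * A + B) - (A + B + A / q * d))
        ≤ q / (q + A) * (y * ((q + A) / q)) := by gcongr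
      _ = y := by
        have : q + A ≠ 0 := by positivity
        field_simp
  · rw [show q + A - d = q - d + A from tsub_add_eq_add_tsub hd |>.symm]
    rcases eq_zero_or_pos (q - d) with h0 | h0
    · rw [h0]; simp
    set e := q - d with he
    have hqe : q = e + d := (tsub_add_cancel_of_le hd).symm
    have hpe : p * e ≤ y := by
      rcases Nat.eq_zero_or_pos p with rfl | hp1
      · simp
      · have h1 : (1 : ℝ≥0) ≤ p := by exact_mod_cast hp1
        rw [← add_le_add_iff_right (p * d)]
        calc p * e + p * d = p * q := by rw [hqe]; ring
          _ ≤ y + 1 * d := by rw [one_mul]; exact hpy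
          _ ≤ y + p * d := by gcongr
    have h1 : y + ((p + 1) * A + B) - (A + B) ≤ y * ((e + A) / e) := by
      rw [tsub_le_iff_right]
      calc y + ((p + 1) * A + B) = A / e * (p * e) + (y + A + B) := by field_simp; ring
        _ ≤ A / e * y + (y + A + B) := by gcongr
        _ = y * ((e + A) / e) + (A + B) := by field_simp; ring
    calc e / (e + A) * (y + ((p + 1) * A + B) - (A + B))
        ≤ e / (e + A) * (y * ((e + A) / e)) := by gcongr
      _ = y := by
        have : e + A ≠ 0 := by positivity
        field_simp

end Network

namespace ServerTrace

variable {n : ℕ} {J : Type} {V F : Type}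

/-- In any backlogged period of a class `c`, that class is served at least `p` quanta up to a residual
deficit, for some number `p` such that any other class is served at most `p + 1` quanta and a residual
deficit. -/
def HasRounds (X : ServerTrace n J) (Q d : Fin n → ℝ≥0) : Prop :=
  ∀ (c : Fin n) (s t : ℝ≥0), s ≤ t →
    (∀ u, s ≤ u → u < t → X.Backlogged (X.ofClass c) u) →
    ∃ p : ℕ, (p * Q c : ℝ≥0∞) ≤ X.servedBits (X.ofClass c) s t + d c ∧
      ∀ j ≠ c, X.servedBits (X.ofClass j) s t ≤ (p + 1) * Q j + d j

variable {X : ServerTrace n J} {N : Network n V F} {v : V}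

theorem HasRounds.gammaConvex_le (hX : X.HasRounds (N.quantum v) (N.dmax v))
    (hagg : X.StrictService Set.univ (N.aggService v)) {c : Fin n} {I : Finset (Fin n)}
    (hI : I ⊆ Finset.univ.erase c) {s t : ℝ≥0} (hst : s ≤ t)
    (hb : ∀ u, s ≤ u → u < t → X.Backlogged (X.ofClass c) u) {a : Fin n → ℝ≥0∞}
    (ha : ∀ j, X.servedBits (X.ofClass j) s t ≤ a j) :
    N.gammaConvex v c I (N.aggService v (t - s) - ∑ j ∈ Finset.univ.erase c \ I, a j)
      ≤ X.servedBits (X.ofClass c) s t := by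
  obtain ⟨p, hp, hj⟩ := hX c s t hst hb
  refine N.gammaConvex_le_of_rounds (D := fun j => X.servedBits (X.ofClass j) s t) ?_ hp
    fun j hjI => hj j (Finset.ne_of_mem_erase (hI hjI))
  rw [tsub_le_iff_right]
  calc N.aggService v (t - s)
      ≤ X.servedBits Set.univ s t :=
        hagg s t hst fun u h1 h2 => (hb u h1 h2).mono (Set.subset_univ _)
    _ = X.servedBits (X.ofClass c) s t + ∑ j ∈ I, X.servedBits (X.ofClass j) s t
        + ∑ j ∈ Finset.univ.erase c \ I, X.servedBits (X.ofClass j) s t := by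
        rw [servedBits_univ, ← Finset.add_sum_erase _ _ (Finset.mem_univ c),
          ← Finset.sum_sdiff hI, add_assoc, add_comm (∑ j ∈ I, _)]
    _ ≤ _ := by
        gcongr with j
        exact ha j

theorem HasRounds.strictService_cdm (hX : X.HasRounds (N.quantum v) (N.dmax v))
    (hagg : X.StrictService Set.univ (N.aggService v)) (c : Fin n) :
    X.StrictService (X.ofClass c) (N.cdm v c) := by
  intro s t hst hb
  have := hX.gammaConvex_le hagg subset_rfl hst hb (a := fun j => X.servedBits (X.ofClass j) s t)
    fun _ => le_rfl
  rwa [Finset.sdiff_self, Finset.sum_empty, tsub_zero] at this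

theorem HasRounds.strictService_improve (hX : X.HasRounds (N.quantum v) (N.dmax v))
    (hagg : X.StrictService Set.univ (N.aggService v)) (hm : ∀ j, Monotone (X.served j))
    {αout β : Fin n → Curve} (hβ : ∀ c, X.StrictService (X.ofClass c) (β c))
    (hα : ∀ c s t, s ≤ t → X.servedBits (X.ofClass c) s t ≤ αout c (t - s)) (c : Fin n) :
    X.StrictService (X.ofClass c) (N.improve v αout β c) := by
  intro s t hst hb
  refine max_le (hβ c s t hst hb) (Finset.sup_le fun I hI => ?_)
  refine N.gammaConvex_iSup_le fun u => ?_
  have hu : s + u.1 ≤ t := by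
    have : u.1 ≤ t - s := u.2
    calc s + u.1 ≤ s + (t - s) := by gcongr
      _ = t := add_tsub_cancel_of_le hst
  -- the class is also backlogged in the first part, of length `u`, of the period
  have := hX.gammaConvex_le hagg (Finset.mem_powerset.1 hI) (le_self_add : s ≤ s + u.1)
    (fun w h1 h2 => hb w h1 (h2.trans_le hu)) (a := fun j => αout j u.1)
    fun j => by simpa using hα j s (s + u.1) le_self_add
  rw [add_tsub_cancel_left] at this
  exact this.trans (servedBits_mono hm le_rfl hu)

/-! ### Output and delay bounds of a FIFO queue -/

open Classical in
/-- Number of bits of the packets of `S` that arrive in the closed interval `[s, t]`. -/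
def arrivedBits (X : ServerTrace n J) (S : Set J) (s t : ℝ≥0) : ℝ≥0∞ :=
  ∑' j : S, if (s : ℝ≥0∞) ≤ X.arr j ∧ X.arr j ≤ t then (X.size j : ℝ≥0∞) else 0

variable {S : Set J}

/-- Beginning `u` of the busy period at time `s`; it is `s` if `S` is not backlogged just before. -/
theorem exists_busy_start {s : ℝ≥0} (hfin : {j ∈ S | X.arr j ≤ s}.Finite) :
    ∃ u ≤ s, (∀ w, u ≤ w → w < s → X.Backlogged S w) ∧ ∀ j ∈ S, X.arr j < u → X.dep j ≤ u := by
  set C : Set ℝ≥0 := {u ∈ insert s ((fun j => (X.arr j).toNNReal) '' {j ∈ S | X.arr j ≤ s}) |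
    u ≤ s ∧ ∀ w, u ≤ w → w < s → X.Backlogged S w} with hC
  have hCfin : C.Finite := ((hfin.image _).insert s).subset (Set.sep_subset _ _)
  have hCne : C.Nonempty := ⟨s, Set.mem_insert _ _, le_rfl, fun w h1 h2 => absurd h1 h2.not_ge⟩
  obtain ⟨u, hu, hmin⟩ := hCfin.exists_minimal hCne
  refine ⟨u, hu.2.1, hu.2.2, fun j hj hju => ?_⟩
  by_contra! hdep
  have hcoe : ((X.arr j).toNNReal : ℝ≥0∞) = X.arr j := ENNReal.coe_toNNReal hju.ne_top
  have hlt : (X.arr j).toNNReal < u := by rw [← hcoe] at hju; exact_mod_cast hju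
  have hle : X.arr j ≤ s := hju.le.trans (by exact_mod_cast hu.2.1)
  have hmem : (X.arr j).toNNReal ∈ C := by
    refine ⟨Set.mem_insert_of_mem _ ⟨j, ⟨hj, hle⟩, rfl⟩, hlt.le.trans hu.2.1, fun w h1 h2 => ?_⟩
    rcases lt_or_ge w u with h | h
    · refine ⟨j, hj, ?_, lt_trans (by exact_mod_cast h) hdep⟩
      rw [← hcoe]; exact_mod_cast h1
    · exact hu.2.2 w h h2
  exact absurd (hmin hmem hlt.le) hlt.not_ge

theorem IsFIFO.servedBits_le_arrivedBits (hF : X.IsFIFO) {u t : ℝ≥0}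
    (hu : ∀ j ∈ S, X.arr j < u → X.dep j ≤ u) (hut : u ≤ t) :
    X.servedBits S u t ≤ X.arrivedBits S u t := by
  refine ENNReal.tsum_le_tsum fun j => ?_
  split_ifs with h
  · refine tsub_le_self.trans ?_
    rcases lt_or_ge (t : ℝ≥0∞) (X.dep j) with h1 | h1
    · exact_mod_cast (hF.served_lt j t h1).le
    · rw [hF.served_eq j t h1]
  · rw [nonpos_iff_eq_zero, tsub_eq_zero_iff_le]
    rw [not_and_or, not_le, not_le] at h
    rcases h with h | h
    · have h1 := hu j j.2 h
      rw [hF.served_eq j u h1, hF.served_eq j t (h1.trans (by exact_mod_cast hut))]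
    · rw [hF.served_eq_zero j t h.le]; simp

/-- The bits of a class that are served in an interval are bounded by the deconvolution of an
arrival curve and a strict service curve. -/
theorem IsFIFO.servedBits_le_deconv (hF : X.IsFIFO) {α β : Curve}
    (hfin : ∀ s : ℝ≥0, {j ∈ S | X.arr j ≤ s}.Finite) (hβ : X.StrictService S β)
    (hβtop : ∀ t, β t ≠ ⊤) (hα : ∀ s t, s < t → X.arrivedBits S s t ≤ α (t - s))
    {s t : ℝ≥0} (hst : s ≤ t) : X.servedBits S s t ≤ deconv α β (t - s) := by
  rcases hst.eq_or_lt with rfl | hlt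
  · rw [servedBits_self]; exact zero_le
  obtain ⟨u, hus, hb, hu⟩ := exists_busy_start (hfin s)
  have h1 : X.servedBits S s t + β (s - u) ≤ α (t - s + (s - u)) := by
    calc X.servedBits S s t + β (s - u)
        ≤ X.servedBits S s t + X.servedBits S u s := by
          gcongr
          exact hβ u s hus hb
      _ = X.servedBits S u t := by rw [add_comm, servedBits_add hF.served_mono hus hst]
      _ ≤ X.arrivedBits S u t := hF.servedBits_le_arrivedBits hu (hus.trans hst)
      _ ≤ α (t - u) := hα u t (hus.trans_lt hlt)
      _ = α (t - s + (s - u)) := by rw [tsub_add_tsub_cancel hst hus]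
  exact (ENNReal.le_sub_of_add_le_right (hβtop _) h1).trans
    (le_iSup (fun r : ℝ≥0 => α (t - s + r) - β r) (s - u))

/-- The delay of a packet is at most the horizontal deviation. The bound `α` is needed only for the
arrivals until the packet itself arrives, and only in the limit `ε → 0`, since the packets that
arrive in a closed interval of length zero need not satisfy `α 0 = 0`. -/
theorem IsFIFO.dep_le_add_hDev (hF : X.IsFIFO) {c : Fin n} {α β : Curve}
    (hfin : ∀ s : ℝ≥0, {j ∈ X.ofClass c | X.arr j ≤ s}.Finite)
    (hβ : X.StrictService (X.ofClass c) β) (hβtop : ∀ t, β t ≠ ⊤) {j : J} (hj : X.cls j = c)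
    {A : ℝ≥0} (hA : X.arr j = A)
    (hα : ∀ u ≤ A, ∀ ε : ℝ≥0, 0 < ε → X.arrivedBits (X.ofClass c) u A ≤ α (A - u + ε)) :
    X.dep j ≤ A + hDev α β := by
  rcases eq_or_ne (hDev α β) ⊤ with htop | htop
  · rw [htop]; simp
  obtain ⟨u, hus, hb, hu⟩ := exists_busy_start (hfin A)
  refine ENNReal.le_of_forall_pos_le_add fun ε hε _ => ?_
  have hε2 : 0 < ε / 2 := half_pos hε
  set τ := A - u + ε / 2 with hτ
  have h1 : (⨅ (δ : ℝ≥0) (_ : α τ ≤ β (τ + δ)), (δ : ℝ≥0∞)) < hDev α β + (ε / 2 : ℝ≥0) :=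
    lt_of_le_of_lt (le_iSup (α := ℝ≥0∞) (fun t : ℝ≥0 =>
      ⨅ (δ : ℝ≥0) (_ : α t ≤ β (t + δ)), (δ : ℝ≥0∞)) τ)
      (ENNReal.lt_add_right htop (by exact_mod_cast hε2.ne'))
  simp only [iInf_lt_iff] at h1
  obtain ⟨δ, hδ, hlt⟩ := h1
  set t := A + ε / 2 + δ with ht
  have hAt : A ≤ t := by rw [ht, add_assoc]; exact le_self_add
  have htu : t - u = τ + δ := by
    rw [ht, hτ, add_assoc, add_assoc, tsub_add_eq_add_tsub hus]
  have hdep : X.dep j ≤ t := by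
    by_contra! hdep
    have hback : ∀ w, u ≤ w → w < t → X.Backlogged (X.ofClass c) w := fun w h1 h2 => by
      rcases lt_or_ge w A with h | h
      · exact hb w h1 h
      · exact ⟨j, hj, by rw [hA]; exact_mod_cast h, lt_trans (by exact_mod_cast h2) hdep⟩
    have h2 : X.arrivedBits (X.ofClass c) u A ≤ X.servedBits (X.ofClass c) u t :=
      calc X.arrivedBits (X.ofClass c) u A ≤ α τ := hα u hus _ hε2
        _ ≤ β (t - u) := by rw [htu]; exact hδ
        _ ≤ _ := hβ u t (hus.trans hAt) hback
    have hfinite : X.arrivedBits (X.ofClass c) u A ≠ ⊤ :=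
      ne_top_of_le_ne_top (hβtop (τ + δ)) ((hα u hus _ hε2).trans hδ)
    -- no packet that arrives after `j` is served, and `j` is not served completely
    have hle : ∀ i : X.ofClass c, (X.served i t : ℝ≥0∞) - X.served i u ≤
        if (u : ℝ≥0∞) ≤ X.arr i ∧ X.arr i ≤ A then (X.size i : ℝ≥0∞) else 0 := fun i => by
      split_ifs with h
      · refine tsub_le_self.trans ?_
        rcases lt_or_ge (t : ℝ≥0∞) (X.dep i) with h1 | h1
        · exact_mod_cast (hF.served_lt i t h1).le
        · rw [hF.served_eq i t h1]
      · rw [nonpos_iff_eq_zero, tsub_eq_zero_iff_le]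
        rw [not_and_or, not_le, not_le] at h
        rcases h with h | h
        · have h1 := hu i i.2 h
          rw [hF.served_eq i u h1,
            hF.served_eq i t (h1.trans (by exact_mod_cast hus.trans hAt))]
        · have h3 : X.served i t = 0 := by
            by_contra h4
            exact absurd (hF.fifo j i t (hj.trans (Eq.symm i.2)) (hA ▸ h)
              (pos_iff_ne_zero.2 h4)) (not_le_of_gt hdep)
          rw [h3]; simp
    have hAu : (u : ℝ≥0∞) ≤ X.arr j ∧ X.arr j ≤ A := by
      rw [hA]; exact ⟨by exact_mod_cast hus, le_rfl⟩
    refine absurd h2 (not_le_of_gt ?_)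
    refine ENNReal.tsum_lt_tsum (i := ⟨j, hj⟩)
      (ne_top_of_le_ne_top hfinite (ENNReal.tsum_le_tsum hle)) hle ?_
    rw [if_pos hAu]
    exact tsub_le_self.trans_lt (by exact_mod_cast hF.served_lt j t hdep)
  calc X.dep j ≤ t := hdep
    _ = A + (ε / 2 : ℝ≥0) + δ := by rw [ht]; push_cast; rfl
    _ ≤ A + (ε / 2 : ℝ≥0) + (hDev α β + (ε / 2 : ℝ≥0)) := by gcongr
    _ = A + hDev α β + (((ε / 2 : ℝ≥0) : ℝ≥0∞) + (ε / 2 : ℝ≥0)) := by ring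
    _ = A + hDev α β + ε := by rw [← ENNReal.coe_add, add_halves]

end ServerTrace

namespace Network

variable {n : ℕ} {V F : Type} {N : Network n V F}

namespace Packets

/-! ### Local properties of a trajectory -/

section Local

variable [NeZero n] {X : N.Packets}

theorem IsTrajectory.unitSizes (hX : X.IsTrajectory) (v : V) :
    (X.trace v).UnitSizes (N.quantum v) (N.lmax v) N.eps where
  quantum := N.quantum_unit v
  eps_le := N.eps_le_lmax v
  size j := hX.size_unit j.1.1
  size_le j := by
    have := hX.size_le j.1.1 j.1.2
    rwa [j.2] at this

theorem IsTrajectory.eps_le_size (hX : X.IsTrajectory) (p : X.P) : N.eps ≤ X.size p := by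
  obtain ⟨m, hm, h⟩ := hX.size_unit p
  rw [h]
  exact le_mul_of_one_le_left zero_le (by exact_mod_cast hm)

theorem IsTrajectory.isFIFO (hX : X.IsTrajectory) (v : V) : (X.trace v).IsFIFO := by
  obtain ⟨before, time, state, tx, hr⟩ := (hX.drr v).exists_isRun
  exact hr.isFIFO fun j => N.eps_pos.trans_le (hX.eps_le_size j.1.1)

theorem IsTrajectory.hasRounds (hX : X.IsTrajectory) (v : V) :
    (X.trace v).HasRounds (N.quantum v) (N.dmax v) := by
  obtain ⟨before, time, state, tx, hr⟩ := (hX.drr v).exists_isRun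
  exact fun c s t hst hb => hr.exists_rounds (hX.isFIFO v) (hX.unitSizes v) hst hb

/-- The passage of a packet through its `k`-th port. -/
def job (X : N.Packets) (p : X.P) (k : Fin (N.hops (X.flow p))) :
    X.Job (N.node (X.flow p) k) := ⟨⟨p, k⟩, rfl⟩

theorem IsTrajectory.arr_le_succ (hX : X.IsTrajectory) (p : X.P) {k : ℕ}
    (hk : k < N.hops (X.flow p)) : X.arr p k ≤ X.arr p (k + 1) :=
  (hX.isFIFO _).arr_le_dep (X.job p ⟨k, hk⟩)

theorem IsTrajectory.arr_lt_succ (hX : X.IsTrajectory) (p : X.P) {k : ℕ}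
    (hk : k < N.hops (X.flow p)) (h : X.arr p k ≠ ⊤) : X.arr p k < X.arr p (k + 1) :=
  (hX.isFIFO _).arr_lt_dep (X.job p ⟨k, hk⟩) h

theorem IsTrajectory.arr_zero_le (hX : X.IsTrajectory) (p : X.P) {k : ℕ}
    (hk : k < N.hops (X.flow p)) : X.arr p 0 ≤ X.arr p k := by
  induction k with
  | zero => exact le_rfl
  | succ k ih => exact (ih (by omega)).trans (hX.arr_le_succ p (by omega))

/-- Only finitely many packets enter the network in a finite time, since the sources are constrained
and the packet sizes bounded from below. -/
theorem IsTrajectory.finite_arr_zero_le [Fintype F] (hX : X.IsTrajectory) (T : ℝ≥0) :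
    {p : X.P | X.arr p 0 ≤ T}.Finite := by
  have h1 : ∀ f, {p : X.P | X.flow p = f ∧ ((0 : ℝ≥0) : ℝ≥0∞) ≤ X.arr p 0 ∧
      X.arr p 0 ≤ T}.Finite := fun f => by
    have h2 : X.arrBits f 0 0 T ≠ ⊤ := by
      refine ne_top_of_le_ne_top ?_ (hX.source f 0 T zero_le)
      finiteness
    have h3 := ENNReal.finite_const_le_of_tsum_ne_top h2
      (ENNReal.coe_ne_zero.2 N.eps_pos.ne')
    refine Set.finite_coe_iff.1 (Set.finite_univ_iff.1 (h3.subset fun p _ => ?_))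
    exact ENNReal.coe_le_coe.2 (hX.eps_le_size p)
  refine (Set.finite_iUnion h1).subset fun p hp => Set.mem_iUnion.2 ⟨X.flow p, rfl, by simp, hp⟩

theorem IsTrajectory.finite_passages [Fintype F] (hX : X.IsTrajectory) (T : ℝ≥0) :
    {x : (p : X.P) × Fin (N.hops (X.flow p)) | X.arr x.1 x.2 ≤ T}.Finite := by
  refine ((hX.finite_arr_zero_le T).biUnion
    fun p _ => Set.finite_range (fun k : Fin (N.hops (X.flow p)) =>
      (⟨p, k⟩ : (p : X.P) × Fin (N.hops (X.flow p))))).subset fun x hx => ?_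
  exact Set.mem_biUnion (x := x.1) ((hX.arr_zero_le x.1 x.2.isLt).trans hx) ⟨x.2, rfl⟩

theorem IsTrajectory.finite_jobs [Fintype F] (hX : X.IsTrajectory) (v : V) (S : Set (X.Job v))
    (T : ℝ≥0) : {j ∈ S | (X.trace v).arr j ≤ T}.Finite :=
  ((hX.finite_passages T).preimage Subtype.val_injective.injOn).subset fun _ hj => hj.2

end Local

/-! ### Arrivals of the flows and of the classes -/

section Arrivals

variable {X : N.Packets}

theorem arrBits_eq_tsum_indicator (f : F) (k : ℕ) (s t : ℝ≥0) :
    X.arrBits f k s t = ∑' p, {p : X.P | X.flow p = f ∧ (s : ℝ≥0∞) ≤ X.arr p k ∧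
      X.arr p k ≤ t}.indicator (fun p => (X.size p : ℝ≥0∞)) p :=
  tsum_subtype {p : X.P | X.flow p = f ∧ (s : ℝ≥0∞) ≤ X.arr p k ∧ X.arr p k ≤ t}
    (fun p => (X.size p : ℝ≥0∞))

/-- The hop of a passage through port `v`. -/
def jobHop (X : N.Packets) {v : V} {c : Fin n} (j : (X.trace v).ofClass c) : N.Hop c :=
  ⟨⟨X.flow j.1.1.1, j.2⟩, j.1.1.2⟩

theorem arrivedBits_le_sum_arrBits [Fintype F] (v : V) (c : Fin n) (s t : ℝ≥0) :
    (X.trace v).arrivedBits ((X.trace v).ofClass c) s t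
      ≤ ∑ h ∈ N.hopsAt c v, X.arrBits h.1 h.2 s t := by
  classical
  unfold ServerTrace.arrivedBits
  set g : (X.trace v).ofClass c → ℝ≥0∞ := fun j =>
    if (s : ℝ≥0∞) ≤ (X.trace v).arr j ∧ (X.trace v).arr j ≤ t then ((X.trace v).size j : ℝ≥0∞)
    else 0 with hg
  have hmem : ∀ j : (X.trace v).ofClass c, X.jobHop j ∈ N.hopsAt c v := fun j =>
    Finset.mem_filter.2 ⟨Finset.mem_univ _, j.1.2⟩
  calc ∑' j, g j = ∑' j, ∑ h ∈ N.hopsAt c v, if X.jobHop j = h then g j else 0 :=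
        tsum_congr fun j => by rw [Finset.sum_ite_eq, if_pos (hmem j)]
    _ = ∑ h ∈ N.hopsAt c v, ∑' j, if X.jobHop j = h then g j else 0 :=
        Summable.tsum_finsetSum fun _ _ => ENNReal.summable
    _ ≤ _ := Finset.sum_le_sum fun h _ => ?_
  set G : X.P → ℝ≥0∞ := {p : X.P | X.flow p = h.1 ∧ (s : ℝ≥0∞) ≤ X.arr p h.2 ∧
      X.arr p h.2 ≤ t}.indicator (fun p => (X.size p : ℝ≥0∞)) with hG
  have hindex : ∀ j : (X.trace v).ofClass c, X.jobHop j = h → (j.1.1.2 : ℕ) = h.2 :=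
    fun j hj => congrArg (fun h : N.Hop c => (h.2 : ℕ)) hj
  have hflow : ∀ j : (X.trace v).ofClass c, X.jobHop j = h → X.flow j.1.1.1 = h.1 :=
    fun j hj => congrArg (fun h : N.Hop c => (h.1 : F)) hj
  have hinj : Function.Injective
      fun j : {j : (X.trace v).ofClass c | X.jobHop j = h} => (j.1.1.1.1 : X.P) := by
    rintro ⟨⟨⟨⟨p, k⟩, h1⟩, h2⟩, h3⟩ ⟨⟨⟨⟨p', k'⟩, h1'⟩, h2'⟩, h3'⟩ (hpp : p = p')
    subst hpp
    have hk : k = k' := Fin.ext ((hindex _ h3).trans (hindex _ h3').symm)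
    subst hk
    rfl
  calc ∑' j, (if X.jobHop j = h then g j else 0)
      = ∑' j, {j : (X.trace v).ofClass c | X.jobHop j = h}.indicator g j :=
        tsum_congr fun j => by simp [Set.indicator_apply]
    _ = ∑' j : {j : (X.trace v).ofClass c | X.jobHop j = h}, g j := (tsum_subtype _ g).symm
    _ ≤ ∑' j : {j : (X.trace v).ofClass c | X.jobHop j = h}, G j.1.1.1.1 := by
        refine ENNReal.tsum_le_tsum fun j => ?_
        simp only [hg]
        split_ifs with hj
        · have hj' : j.1.1.1.1 ∈ {p : X.P | X.flow p = h.1 ∧ (s : ℝ≥0∞) ≤ X.arr p h.2 ∧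
              X.arr p h.2 ≤ t} := by
            refine ⟨hflow j.1 j.2, ?_⟩
            rw [← hindex j.1 j.2]
            exact hj
          rw [hG, Set.indicator_of_mem hj']
          exact le_rfl
        · exact zero_le
    _ ≤ ∑' p, G p := ENNReal.tsum_comp_le_tsum_of_injective hinj G
    _ = X.arrBits h.1 h.2 s t := (arrBits_eq_tsum_indicator _ _ _ _).symm

theorem arrivedBits_le_arrivalCurve [Fintype F] {c : Fin n} {z : N.Hop c → ℝ≥0∞} (v : V)
    {s t τ : ℝ≥0}
    (hb : ∀ h : N.Hop c,
      X.arrBits h.1 h.2 s t ≤ N.inBurst z h + N.rate h.1 * ((t - s : ℝ≥0) : ℝ≥0∞))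
    (hτ : t - s ≤ τ) (hτ0 : 0 < τ) :
    (X.trace v).arrivedBits ((X.trace v).ofClass c) s t ≤ N.arrivalCurve c z v τ := by
  refine (arrivedBits_le_sum_arrBits v c s t).trans (Finset.sum_le_sum fun h _ => ?_)
  rw [tokenBucket, if_neg hτ0.ne']
  exact (hb h).trans (by gcongr)

/-- The packets of a flow that arrive by time `t`, and no more than `D` before time `s`. For
`D = ⊤` a flow of positive rate has no useful bound, and a flow of rate zero never sends more than
its burst. -/
theorem tsum_delayed_le {f : F} {k : ℕ} {r : ℝ≥0} {b D : ℝ≥0∞} {s t : ℝ≥0} (hst : s ≤ t)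
    (hb : ∀ s ≤ t, X.arrBits f k s t ≤ b + r * ((t - s : ℝ≥0) : ℝ≥0∞)) :
    ∑' p : {p : X.P | X.flow p = f ∧ (s : ℝ≥0∞) ≤ X.arr p k + D ∧ X.arr p k ≤ t},
      (X.size p : ℝ≥0∞) ≤ b + r * D + r * ((t - s : ℝ≥0) : ℝ≥0∞) := by
  have hsub : ∀ s' : ℝ≥0, (∀ p, (s : ℝ≥0∞) ≤ X.arr p k + D → (s' : ℝ≥0∞) ≤ X.arr p k) →
      ∑' p : {p : X.P | X.flow p = f ∧ (s : ℝ≥0∞) ≤ X.arr p k + D ∧ X.arr p k ≤ t},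
        (X.size p : ℝ≥0∞) ≤ X.arrBits f k s' t := fun s' h =>
    ENNReal.tsum_mono_subtype (fun p : X.P => (X.size p : ℝ≥0∞))
      (t := {p | X.flow p = f ∧ (s' : ℝ≥0∞) ≤ X.arr p k ∧ X.arr p k ≤ t})
      fun p hp => ⟨hp.1, h p hp.2.1, hp.2.2⟩
  induction D with
  | top =>
    rcases eq_or_ne r 0 with rfl | hr
    · simpa using (hsub 0 (by simp)).trans (hb 0 zero_le)
    · rw [ENNReal.mul_top (by exact_mod_cast hr)]
      simp
  | coe D =>
    refine (hsub (s - D) fun p hp => ?_).trans ((hb (s - D) (tsub_le_self.trans hst)).trans ?_)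
    · push_cast
      exact tsub_le_iff_right.2 hp
    · have h1 : t - (s - D) ≤ D + (t - s) := by
        rw [tsub_le_iff_right]
        calc t = (t - s) + s := (tsub_add_cancel_of_le hst).symm
          _ ≤ (t - s) + (s - D + D) := by gcongr; exact le_tsub_add
          _ = D + (t - s) + (s - D) := by ring
      rw [add_assoc, ← mul_add]
      gcongr
      exact_mod_cast h1

/-- The bits of a flow at the output of a port, given its burstiness at the input and a delay
bound `D` for the packets that arrive before time `A`. -/
theorem IsTrajectory.arrBits_succ_le [NeZero n] (hX : X.IsTrajectory) {f : F} {k : ℕ}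
    (hk : k < N.hops f) {r : ℝ≥0} {b D A : ℝ≥0∞}
    (hD : ∀ p, X.flow p = f → X.arr p k < A → X.arr p (k + 1) ≤ X.arr p k + D)
    {s t : ℝ≥0} (hst : s ≤ t) (htA : (t : ℝ≥0∞) ≤ A)
    (hb : ∀ s ≤ t, X.arrBits f k s t ≤ b + r * ((t - s : ℝ≥0) : ℝ≥0∞)) :
    X.arrBits f (k + 1) s t ≤ b + r * D + r * ((t - s : ℝ≥0) : ℝ≥0∞) := by
  refine le_trans ?_ (tsum_delayed_le (D := D) hst hb)
  refine ENNReal.tsum_mono_subtype (fun p : X.P => (X.size p : ℝ≥0∞))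
    (s := {p | X.flow p = f ∧ (s : ℝ≥0∞) ≤ X.arr p (k + 1) ∧ X.arr p (k + 1) ≤ t})
    fun p hp => ?_
  obtain ⟨h1, h2, h3⟩ := hp
  have hk' : k < N.hops (X.flow p) := h1 ▸ hk
  have h4 := (hX.arr_le_succ p hk').trans h3
  -- transmission takes time, so the packet arrived strictly before time `A`
  have h5 : X.arr p k < A :=
    (hX.arr_lt_succ p hk' (ne_top_of_le_ne_top ENNReal.coe_ne_top h4)).trans_le (h3.trans htA)
  exact ⟨h1, h2.trans (hD p h1 h5), h4⟩

theorem IsTrajectory.outBits_le [NeZero n] (hX : X.IsTrajectory) {f : F} {k : ℕ}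
    (hk : k < N.hops f) {r : ℝ≥0} {b D : ℝ≥0∞}
    (hD : ∀ p, X.flow p = f → X.arr p (k + 1) ≤ X.arr p k + D) {s t : ℝ≥0} (hst : s ≤ t)
    (hb : ∀ s ≤ t, X.arrBits f k s t ≤ b + r * ((t - s : ℝ≥0) : ℝ≥0∞)) :
    X.outBits f k s t ≤ b + r * D + r * ((t - s : ℝ≥0) : ℝ≥0∞) := by
  refine le_trans ?_ (tsum_delayed_le (D := D) hst hb)
  unfold outBits
  refine (tsum_subtype {p : X.P | X.flow p = f}
    (fun p => (X.served p k t : ℝ≥0∞) - X.served p k s)).trans_le ?_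
  rw [tsum_subtype _ (fun p : X.P => (X.size p : ℝ≥0∞))]
  refine ENNReal.tsum_le_tsum fun p => ?_
  refine Set.indicator_apply_le' (fun hp => ?_) (fun _ => zero_le)
  have hp' : X.flow p = f := hp
  have hF := hX.isFIFO (N.node (X.flow p) ⟨k, hp' ▸ hk⟩)
  set j := X.job p ⟨k, hp' ▸ hk⟩
  have hserved : ∀ u, X.served p k u = (X.trace _).served j u := fun _ => rfl
  have hle : X.served p k t ≤ X.size p := by
    rcases lt_or_ge (t : ℝ≥0∞) ((X.trace _).dep j) with h | h
    · exact (hF.served_lt j t h).le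
    · exact (hF.served_eq j t h).le
  by_cases h : (s : ℝ≥0∞) ≤ X.arr p k + D ∧ X.arr p k ≤ t
  · rw [Set.indicator_of_mem (show p ∈ {p : X.P | X.flow p = f ∧ (s : ℝ≥0∞) ≤ X.arr p k + D ∧
      X.arr p k ≤ t} from ⟨hp', h⟩)]
    exact tsub_le_self.trans (by exact_mod_cast hle)
  · refine le_of_eq_of_le ?_ zero_le
    rw [tsub_eq_zero_iff_le]
    rw [not_and_or, not_le, not_le] at h
    rcases h with h | h
    · have h1 : (X.trace _).dep j ≤ s := (hD p hp').trans h.le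
      rw [hserved s, hF.served_eq j s h1]
      exact_mod_cast hle
    · rw [hserved t, hF.served_eq_zero j t h.le]
      simp

end Arrivals

/-! ### Validity of total flow analysis -/

section TFA

variable [NeZero n] {X : N.Packets} {c : Fin n} {z : N.Hop c → ℝ≥0∞} {d : V → ℝ≥0∞}

/-- Burst bounds propagate along the path of a flow, up to time `A`, if the delay bounds hold for
the packets that arrive before time `A`. -/
theorem IsTrajectory.arrBits_le_inBurst (hX : X.IsTrajectory)
    (hz : ∀ h, N.inBurst z h + N.rate h.1 * d (N.port h) ≤ z h) {A : ℝ≥0∞}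
    (hd : ∀ p (k : Fin (N.hops (X.flow p))), N.cls (X.flow p) = c → X.arr p k < A →
      X.arr p (k + 1) ≤ X.arr p k + d (N.node _ k))
    (f : N.FlowOf c) (k : ℕ) (hk : k < N.hops f) {s t : ℝ≥0} (hst : s ≤ t)
    (htA : (t : ℝ≥0∞) ≤ A) :
    X.arrBits f k s t ≤ N.inBurst z ⟨f, k, hk⟩ + N.rate f * ((t - s : ℝ≥0) : ℝ≥0∞) := by
  induction k generalizing s with
  | zero => simpa [inBurst] using hX.source f s t hst
  | succ k ih =>
    have hk' : k < N.hops f := by omega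
    have h1 : N.inBurst z ⟨f, k + 1, hk⟩ = z ⟨f, k, hk'⟩ := by simp [inBurst]
    rw [h1]
    refine (hX.arrBits_succ_le hk' (D := d (N.port ⟨f, k, hk'⟩)) (A := A) ?_ hst htA
      fun s hs => ih hk' hs).trans (by gcongr; exact hz ⟨f, k, hk'⟩)
    intro p hp hA
    obtain ⟨f, hf⟩ := f
    obtain rfl : X.flow p = f := hp
    exact hd p ⟨k, hk'⟩ hf hA

variable [Fintype F] {β : V → Curve}

/-- The delay bounds of total flow analysis hold on every trajectory, whatever cycles the paths form.
A packet that violates its bound and arrives first among all such packets yields a contradiction: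
the arrivals that matter for its delay left their previous ports at most at its arrival time, and
arrived there strictly earlier, so that the delay bounds hold for them. -/
theorem IsTrajectory.arr_succ_le_add_delay (hX : X.IsTrajectory)
    (hβ : ∀ v, (X.trace v).StrictService ((X.trace v).ofClass c) (β v))
    (hβtop : ∀ v t, β v t ≠ ⊤) (hβmono : ∀ v, Monotone (β v)) (p : X.P)
    (k : Fin (N.hops (X.flow p))) (hp : N.cls (X.flow p) = c) :
    X.arr p (k + 1) ≤ X.arr p k + (N.genericTFA c β).1 (N.node _ k) := by
  set z := (N.genericTFA c β).2 with hzdef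
  set d := (N.genericTFA c β).1 with hddef
  have hz : ∀ h, N.inBurst z h + N.rate h.1 * d (N.port h) ≤ z h :=
    N.tfaStep_genericTFA_le c hβmono
  by_contra! hbad
  set B : Set ((p : X.P) × Fin (N.hops (X.flow p))) := {x | N.cls (X.flow x.1) = c ∧
    X.arr x.1 x.2 + d (N.node _ x.2) < X.arr x.1 (x.2 + 1)} with hB
  have hfinarr : ∀ x ∈ B, X.arr x.1 x.2 ≠ ⊤ := fun x hx h => by
    have := hx.2
    rw [h, top_add] at this
    exact not_top_lt this
  have hx0 : (⟨p, k⟩ : (p : X.P) × Fin (N.hops (X.flow p))) ∈ B := ⟨hp, hbad⟩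
  obtain ⟨A0, hA0⟩ : ∃ A0 : ℝ≥0, (A0 : ℝ≥0∞) = X.arr p k :=
    ⟨_, ENNReal.coe_toNNReal (hfinarr _ hx0)⟩
  obtain ⟨x, ⟨hxB, hxA⟩, hmin⟩ := Set.exists_min_image
    {x ∈ B | X.arr x.1 x.2 ≤ A0} (fun x => X.arr x.1 x.2)
    ((hX.finite_passages A0).subset fun x hx => hx.2) ⟨_, hx0, hA0.ge⟩
  obtain ⟨A, hA⟩ : ∃ A : ℝ≥0, (A : ℝ≥0∞) = X.arr x.1 x.2 :=
    ⟨_, ENNReal.coe_toNNReal (hfinarr x hxB)⟩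
  have hgood : ∀ p (k : Fin (N.hops (X.flow p))), N.cls (X.flow p) = c → X.arr p k < A →
      X.arr p (k + 1) ≤ X.arr p k + d (N.node _ k) := by
    intro q l hq hlt
    by_contra! hqbad
    have hle : X.arr q l ≤ A0 := hlt.le.trans (hA.trans_le hxA)
    exact absurd (hmin ⟨q, l⟩ ⟨⟨hq, hqbad⟩, hle⟩) (not_le_of_gt (hA ▸ hlt))
  have hdelay := (hX.isFIFO (N.node _ x.2)).dep_le_add_hDev (c := c)
    (α := N.arrivalCurve c z (N.node _ x.2)) (hX.finite_jobs _ _) (hβ _) (hβtop _)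
    (j := X.job x.1 x.2) hxB.1 (A := A) hA.symm fun u hu ε hε =>
      arrivedBits_le_arrivalCurve _
        (fun h => hX.arrBits_le_inBurst hz hgood h.1 h.2 h.2.isLt hu le_rfl) le_self_add
        (add_pos_of_nonneg_of_pos zero_le hε)
  rw [hA] at hdelay
  exact absurd hxB.2 (not_lt_of_ge hdelay)

theorem IsTrajectory.arrBits_le_genericTFA (hX : X.IsTrajectory)
    (hβ : ∀ v, (X.trace v).StrictService ((X.trace v).ofClass c) (β v))
    (hβtop : ∀ v t, β v t ≠ ⊤) (hβmono : ∀ v, Monotone (β v)) (h : N.Hop c) {s t : ℝ≥0}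
    (hst : s ≤ t) : X.arrBits h.1 h.2 s t
      ≤ N.inBurst (N.genericTFA c β).2 h + N.rate h.1 * ((t - s : ℝ≥0) : ℝ≥0∞) :=
  hX.arrBits_le_inBurst (d := (N.genericTFA c β).1) (A := ⊤) (N.tfaStep_genericTFA_le c hβmono)
    (fun p k hp _ => hX.arr_succ_le_add_delay hβ hβtop hβmono p k hp) h.1 h.2 h.2.isLt hst le_top

theorem IsTrajectory.isBurstBound_sum (hX : X.IsTrajectory)
    (hβ : ∀ v, (X.trace v).StrictService ((X.trace v).ofClass c) (β v))
    (hβtop : ∀ v t, β v t ≠ ⊤) (hβmono : ∀ v, Monotone (β v)) (H : Finset (N.Hop c)) :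
    X.IsBurstBound H (∑ h ∈ H, (N.genericTFA c β).2 h) := by
  intro s t hst
  have hz := N.tfaStep_genericTFA_le c hβmono
  have hD : ∀ (h : N.Hop c) p, X.flow p = h.1 → X.arr p (h.2 + 1) ≤
      X.arr p h.2 + (N.genericTFA c β).1 (N.port h) := by
    rintro ⟨⟨f, hf⟩, k⟩ p rfl
    exact hX.arr_succ_le_add_delay hβ hβtop hβmono p k hf
  have hb : ∀ (h : N.Hop c), ∀ s ≤ t, X.arrBits h.1 h.2 s t
      ≤ N.inBurst (N.genericTFA c β).2 h + N.rate h.1 * ((t - s : ℝ≥0) : ℝ≥0∞) :=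
    fun h _ hs => hX.arrBits_le_genericTFA hβ hβtop hβmono h hs
  rw [Finset.sum_mul, ← Finset.sum_add_distrib]
  exact ⟨Finset.sum_le_sum fun h _ => (hX.outBits_le h.2.isLt (hD h) hst (hb h)).trans
      (add_le_add_left (hz h) _),
    Finset.sum_le_sum fun h _ => (hX.arrBits_succ_le h.2.isLt (A := ⊤) (fun p hp _ => hD h p hp)
      hst le_top (hb h)).trans (add_le_add_left (hz h) _)⟩

end TFA

/-! ### Validity of the service curves -/

section Service

variable [NeZero n] {X : N.Packets}

theorem IsTrajectory.strictService_improveIter [Fintype F] (hX : X.IsTrajectory) (v : V)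
    {α : Fin n → Curve}
    (hα : ∀ c s t, s < t → (X.trace v).arrivedBits ((X.trace v).ofClass c) s t ≤ α c (t - s))
    (i : ℕ) (c : Fin n) :
    (X.trace v).StrictService ((X.trace v).ofClass c) (N.improveIter v α i c) := by
  have hF := hX.isFIFO v
  induction i generalizing c with
  | zero => exact (hX.hasRounds v).strictService_cdm (hX.service v) c
  | succ i ih =>
    refine (hX.hasRounds v).strictService_improve (hX.service v) hF.served_mono ih
      (fun c s t hst => ?_) c
    exact hF.servedBits_le_deconv (hX.finite_jobs v _) (ih c)
      (fun t => ne_top_of_le_ne_top (N.aggService_ne_top v t) (N.improveIter_le v α i c t))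
      (hα c) hst

theorem IsTrajectory.strictService_serviceIter [Fintype F] (hX : X.IsTrajectory)
    (m : ℕ → V → ℕ∞) (k : ℕ) (c : Fin n) (v : V) :
    (X.trace v).StrictService ((X.trace v).ofClass c) (N.serviceIter m k c v) := by
  induction k generalizing c v with
  | zero => exact (hX.hasRounds v).strictService_cdm (hX.service v) c
  | succ k ih =>
    have hα : ∀ c' s t, s < t → (X.trace v).arrivedBits ((X.trace v).ofClass c') s t
        ≤ N.arrivalCurve c' (N.genericTFA c' (N.serviceIter m k c')).2 v (t - s) :=
      fun c' s t hst => arrivedBits_le_arrivalCurve v (fun h =>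
        hX.arrBits_le_genericTFA (ih c') (N.serviceIter_ne_top m k c')
          (N.serviceIter_monotone m k c') h hst.le) le_rfl (tsub_pos_of_lt hst)
    intro s t hst hb
    simp only [serviceIter, drrService]
    split_ifs
    · exact iSup_le fun i => hX.strictService_improveIter v hα i c s t hst hb
    · exact hX.strictService_improveIter v hα _ c s t hst hb

end Service

end Packets

theorem algorithm_valid [NeZero n] [Fintype F] (N : Network n V F) (m : ℕ → V → ℕ∞)
    (Ecut : Fin n → Set (V × V)) (k : ℕ) : (N.algorithm m Ecut k).Valid := by
  have hB : ∀ X : N.Packets, X.IsTrajectory → ∀ c (H : Finset (N.Hop c)),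
      X.IsBurstBound H (∑ h ∈ H, (N.genericTFA c (N.serviceIter m k c)).2 h) := fun X hX c H =>
    hX.isBurstBound_sum (hX.strictService_serviceIter m k c) (N.serviceIter_ne_top m k c)
      (N.serviceIter_monotone m k c) H
  refine ⟨N.serviceIter_ne_top m k, fun X hX c v => hX.strictService_serviceIter m k c v,
    fun X hX c v j hj => ?_, fun X hX c h => ?_, fun X hX c h => ?_,
    fun X hX c e => hB X hX c _, fun X hX c v => hB X hX c _⟩
  · obtain ⟨⟨p, l⟩, rfl⟩ := j
    exact hX.arr_succ_le_add_delay (hX.strictService_serviceIter m k c)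
      (N.serviceIter_ne_top m k c) (N.serviceIter_monotone m k c) p l hj
  · have := hB X hX c {h}
    rwa [Finset.sum_singleton] at this
  · have := hB X hX c {h.1}
    rwa [Finset.sum_singleton] at this

end Network

end DRR

end

theorem theorem3 {n : ℕ} [NeZero n] {V F : Type} [Fintype F] (N : DRR.Network n V F)
    (Ecut : Fin n → Set (V × V)) (hcut : ∀ c, Ecut c ⊆ N.edges c) (m : ℕ → V → ℕ∞) :
    (∀ k, (N.algorithm m Ecut k).Valid) ∧
      ((∀ v, Monotone fun k => m k v) →
        DRR.Network.Bounds.Converges fun k => N.algorithm m Ecut k) :=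
  ⟨fun k => N.algorithm_valid m Ecut k, fun hm => N.algorithm_converges hm Ecut⟩
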